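/- Let $\Bbbk$ be a field of prime characteristic $p>0$, let $\Delta$ be a simplicial complex on a finite vertex set, and let $R=\Bbbk[\Delta]$ be its Stanley–Reisner ring, with maximal homogeneous ideal $\mathfrak m=(x_v : v \text{ a vertex})$. Assume that $R$ is Cohen–Macaulay of dimension $d\ge 1$. Let $I_1,\dots,I_d$ be ideals of $R$, each generated by a linear system of parameters of $R$ (that is, by $d$ linear forms $\theta_1,\dots,\theta_d$ with $R/(\theta_1,\dots,\theta_d)$ finite-dimensional over $\Bbbk$), and let $(a_1,\dots,a_d)$ be a joint reduction of $(I_1,\dots,I_d)$, i.e. $a_i\in I_i$ and $\sum_i a_i\prod_{j\ne i}I_j$ is a reduction of $I_1\cdots I_d$. Notation. $J$ is a reduction of $I$ if $J\subseteq I$ and $JI^n=I^{n+1}$ for all large $n$; then $r_J(I)$ is the least $n\ge 0$ with $JI^n=I^{n+1}$, and $r(I)=\min\{r_J(I) : J \text{ a minimal reduction of } I\}$. $I^*$ is the tight closure of $I$. For an ideal $K$ such that $R/(K^n)^*$ has finite length for all large $n$, the tight Hilbert coefficients $e_i^*(K)\in\mathbb Z$ are given by $$\ell\big(R/(K^n)^*\big)=\sum_{i=0}^{d}(-1)^i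 e_i^*(K)\binom{n+d-1-i}{d-i}\qquad\text{for all large } n .$$ The Euler characteristic is $\chi(\Delta)=f_0-f_1+\cdots+(-1)^{d-1}f_{d-1}$, where $f_i$ is the number of $i$-dimensional faces, and $\Delta$ is called Eulerian if $\chi(\Delta)=1$. For $S=(s_1,\dots,s_d)$ put $\underline I^{S}=\prod_j I_j^{s_j}$ and $\underline I^{S_i}=I_i^{s_i-1}\prod_{j\ne i}I_j^{s_j}$. Then the tight Hilbert coefficients of $\prod_{j\in T}I_j$ exist for every nonempty $T\subseteq\{1,\dots,d\}$. Consider the conditions 1. $\Delta$ is Eulerian; 2. $r(\mathfrak m)\le d-1$; 3. $a_1(\underline I^{S_1})^*+\cdots+a_d(\underline I^{S_d})^*=(\underline I^{S})^*$ for all $s_1,\dots,s_d\ge 1$; 4. $\displaystyle\sum_{\emptyset\ne T\subseteq\{1,\dots,d\}}(-1)^{d-|T|}\,e_d^*\Big(\prod_{j\in T}I_j\Big)=0$, that is, $e_d^*(I_1\cdots I_d)-\sum_i e_d^*\big(\prod_{j\ne i}I_j\big)+\sum_{p<q}e_d^*\big(\prod_{j\ne p,q}I_j\big)-\cdots+(-1)^{d-1}\sum_i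 e_d^*(I_i)=0$. If $\Bbbk$ is infinite, then (1), (2), (3) and (4) are equivalent. For an arbitrary $\Bbbk$ of characteristic $p$, the conditions (1), (3) and (4) are equivalent, and they imply (2). -/

import Mathlib

open Filter

noncomputable section

/-! ### Tight closure and the tight Hilbert coefficients -/

section TightClosure

variable {R : Type*} [CommRing R]

/-- `R°`: the elements of `R` that lie in no minimal prime ideal of `R`. -/
def ringCirc (R : Type*) [CommRing R] : Set R :=
  {c | ∀ P ∈ minimalPrimes R, c ∉ P}

lemma one_mem_ringCirc : (1 : R) ∈ ringCirc R := fun P hP h =>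
  hP.1.1.ne_top ((Ideal.eq_top_iff_one P).2 h)

lemma mul_mem_ringCirc {a b : R} (ha : a ∈ ringCirc R) (hb : b ∈ ringCirc R) :
    a * b ∈ ringCirc R := fun P hP h =>
  (hP.1.1.mem_or_mem h).elim (ha P hP) (hb P hP)

/-- The Frobenius power `I^[q]`, `q = p ^ e`: the ideal generated by all `x ^ q` with `x ∈ I`. -/
def frobeniusPower (p : ℕ) [Fact p.Prime] [CharP R p] (I : Ideal R) (e : ℕ) : Ideal R :=
  I.map (iterateFrobenius R p e)

/-- The tight closure `I^*`: all `x` for which some `c ∈ R°` satisfies `c * x ^ q ∈ I^[q]` for all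
sufficiently large `q = p ^ e`. -/
def tightClosure (p : ℕ) [Fact p.Prime] [CharP R p] (I : Ideal R) : Ideal R where
  carrier := {x | ∃ c ∈ ringCirc R, ∀ᶠ e : ℕ in atTop, c * x ^ p ^ e ∈ frobeniusPower p I e}
  zero_mem' := ⟨1, one_mem_ringCirc, Eventually.of_forall fun e => by
    rw [zero_pow (pow_ne_zero _ (Fact.out : p.Prime).ne_zero), mul_zero]
    exact Ideal.zero_mem _⟩
  add_mem' := by
    rintro x y ⟨c, hc, hx⟩ ⟨c', hc', hy⟩
    refine ⟨c * c', mul_mem_ringCirc hc hc', ?_⟩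
    filter_upwards [hx, hy] with e h1 h2
    have h : c * c' * (x + y) ^ p ^ e = c' * (c * x ^ p ^ e) + c * (c' * y ^ p ^ e) := by
      rw [add_pow_char_pow]; ring
    rw [h]
    exact Ideal.add_mem _ (Ideal.mul_mem_left _ _ h1) (Ideal.mul_mem_left _ _ h2)
  smul_mem' := by
    rintro r x ⟨c, hc, hx⟩
    refine ⟨c, hc, ?_⟩
    filter_upwards [hx] with e h1
    have h : c * (r • x) ^ p ^ e = r ^ p ^ e * (c * x ^ p ^ e) := by
      rw [smul_eq_mul, mul_pow]; ring
    rw [h]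
    exact Ideal.mul_mem_left _ _ h1

/-- `e 0, …, e d` are the coefficients of the tight Hilbert polynomial of `I`: for all large `n`,
the length of `R / (I ^ n)^*` is finite and equals
`∑ i, (-1) ^ i * e i * (n + d - 1 - i choose d - i)`. -/
def IsTightHilbertCoeffs (p : ℕ) [Fact p.Prime] [CharP R p] (d : ℕ) (I : Ideal R)
    (e : Fin (d + 1) → ℤ) : Prop :=
  ∀ᶠ n : ℕ in atTop,
    Module.length R (R ⧸ tightClosure p (I ^ n)) ≠ ⊤ ∧
    ((Module.length R (R ⧸ tightClosure p (I ^ n))).toNat : ℤ) =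
      ∑ i : Fin (d + 1),
        (-1) ^ (i : ℕ) * e i * (Nat.choose (n + d - 1 - (i : ℕ)) (d - (i : ℕ)) : ℤ)

open Classical in
/-- The last coefficient `e_d^*(I)` of the tight Hilbert polynomial (which is unique when it exists;
the value is `0` when it does not). -/
def lastTightHilbertCoeff (p : ℕ) [Fact p.Prime] [CharP R p] (d : ℕ) (I : Ideal R) : ℤ :=
  if h : ∃ e : Fin (d + 1) → ℤ, IsTightHilbertCoeffs p d I e then h.choose (Fin.last d) else 0

end TightClosure

/-! ### Reductions, reduction numbers, joint reductions -/

section Reductions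

variable {R : Type*} [CommRing R]

/-- `J` is a reduction of `I`. -/
def Ideal.IsReductionOf (J I : Ideal R) : Prop :=
  J ≤ I ∧ ∀ᶠ n : ℕ in atTop, J * I ^ n = I ^ (n + 1)

/-- A reduction of `I` that is minimal under inclusion among the reductions of `I`. -/
def Ideal.IsMinimalReductionOf (J I : Ideal R) : Prop :=
  Minimal (fun J' : Ideal R => J'.IsReductionOf I) J

/-- `r_J(I)`: the least `n` with `J I^n = I^(n+1)`, for a reduction `J` of `I`. -/
def Ideal.reductionNumberWith (J I : Ideal R) : ℕ :=
  sInf {n : ℕ | J * I ^ n = I ^ (n + 1)}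

/-- `r(I)`: the minimum of `r_J(I)` over the minimal reductions `J` of `I`
(`⊤` if there is no minimal reduction). -/
def Ideal.reductionNumber (I : Ideal R) : ℕ∞ :=
  ⨅ (J : Ideal R) (_ : J.IsMinimalReductionOf I), (J.reductionNumberWith I : ℕ∞)

/-- `(a_1, …, a_d)` is a joint reduction of `(I_1, …, I_d)`. -/
def IsJointReduction {d : ℕ} (a : Fin d → R) (I : Fin d → Ideal R) : Prop :=
  (∀ i, a i ∈ I i) ∧
    (∑ i, Ideal.span {a i} * ∏ j ∈ Finset.univ.erase i, I j).IsReductionOf (∏ j, I j)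

end Reductions

/-! ### Cohen–Macaulay rings -/

/-- A (Noetherian) local ring is Cohen–Macaulay: its dimension is the length of some regular
sequence. (A regular sequence generates a proper ideal, so it lies in the maximal ideal.) -/
def IsCohenMacaulayLocal (A : Type*) [CommRing A] : Prop :=
  ∃ rs : List A, RingTheory.Sequence.IsRegular A rs ∧ (rs.length : WithBot ℕ∞) = ringKrullDim A

/-- A Noetherian ring is Cohen–Macaulay if its localizations at all maximal ideals are. -/
def IsCohenMacaulay (R : Type*) [CommRing R] : Prop :=
  IsNoetherianRing R ∧
    ∀ (M : Ideal R) [M.IsMaximal], IsCohenMacaulayLocal (Localization.AtPrime M)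

/-! ### Stanley–Reisner rings -/

section StanleyReisner

variable (k : Type*) [Field k] {V : Type*}

/-- The ideal `I_Δ`, generated by the squarefree monomials of the nonfaces of `Δ`. (The faces
recorded by `AbstractSimplicialComplex` are the nonempty ones; the empty set is a face as well.) -/
def stanleyReisnerIdeal (Δ : AbstractSimplicialComplex V) : Ideal (MvPolynomial V k) :=
  Ideal.span {f | ∃ σ : Finset V, σ.Nonempty ∧ σ ∉ Δ.faces ∧ f = ∏ i ∈ σ, MvPolynomial.X i}

/-- The Stanley–Reisner ring `k[Δ]`. -/
abbrev StanleyReisnerRing (Δ : AbstractSimplicialComplex V) : Type _ :=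
  MvPolynomial V k ⧸ stanleyReisnerIdeal k Δ

lemma stanleyReisnerIdeal_ne_top (Δ : AbstractSimplicialComplex V) :
    stanleyReisnerIdeal k Δ ≠ ⊤ := by
  intro h
  have hle : stanleyReisnerIdeal k Δ ≤
      RingHom.ker (MvPolynomial.constantCoeff : MvPolynomial V k →+* k) := by
    refine Ideal.span_le.2 ?_
    rintro f ⟨σ, ⟨i, hi⟩, -, rfl⟩
    simp only [SetLike.mem_coe, RingHom.mem_ker, map_prod, MvPolynomial.constantCoeff_X]
    exact Finset.prod_eq_zero hi rfl
  rw [h, top_le_iff] at hle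
  exact RingHom.ker_ne_top _ hle

instance instNontrivialStanleyReisnerRing (Δ : AbstractSimplicialComplex V) :
    Nontrivial (StanleyReisnerRing k Δ) :=
  Ideal.Quotient.nontrivial_iff.2 (stanleyReisnerIdeal_ne_top k Δ)

instance instCharPStanleyReisnerRing (Δ : AbstractSimplicialComplex V) (p : ℕ) [CharP k p] :
    CharP (StanleyReisnerRing k Δ) p :=
  charP_of_injective_algebraMap (algebraMap k (StanleyReisnerRing k Δ)).injective p

/-- The image `x_i` of the variable `X_i` in `k[Δ]`. -/
def srVar (Δ : AbstractSimplicialComplex V) (i : V) : StanleyReisnerRing k Δ :=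
  Ideal.Quotient.mk (stanleyReisnerIdeal k Δ) (MvPolynomial.X i)

/-- The maximal homogeneous ideal `𝔪 = (x_i : i ∈ V)` of `k[Δ]`. -/
def srMaxIdeal (Δ : AbstractSimplicialComplex V) : Ideal (StanleyReisnerRing k Δ) :=
  Ideal.span (Set.range (srVar k Δ))

/-- `θ_1, …, θ_d` is a linear system of parameters of `k[Δ]`, where `d = dim k[Δ]`: every `θ_i` is a
linear form and `k[Δ] / (θ_1, …, θ_d)` is a finite-dimensional `k`-vector space. -/
def IsLinearSOP (Δ : AbstractSimplicialComplex V) {d : ℕ} (θ : Fin d → StanleyReisnerRing k Δ) :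
    Prop :=
  (d : WithBot ℕ∞) = ringKrullDim (StanleyReisnerRing k Δ) ∧
    (∀ i, θ i ∈ Submodule.span k (Set.range (srVar k Δ))) ∧
    Module.Finite k (StanleyReisnerRing k Δ ⧸ Ideal.span (Set.range θ))

end StanleyReisner

open Classical in
/-- The Euler characteristic `χ(Δ) = f_0 - f_1 + f_2 - ⋯`: each nonempty face `σ` contributes
`(-1) ^ dim σ`, `dim σ = #σ - 1`. -/
def simplicialEulerChar {V : Type*} [Fintype V] (Δ : AbstractSimplicialComplex V) : ℤ :=
  ∑ σ ∈ Finset.univ.filter (fun σ : Finset V => σ ∈ Δ.faces), (-1) ^ (σ.card - 1)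

/-- `Δ` is Eulerian in the sense that `χ(Δ) = 1`. -/
def IsEulerianComplex {V : Type*} [Fintype V] (Δ : AbstractSimplicialComplex V) : Prop :=
  simplicialEulerChar Δ = 1

/-! ### The two conditions on the ideals -/

/-- `a_1 (I^{S_1})^* + ⋯ + a_d (I^{S_d})^* = (I^S)^*` for all `s_1, …, s_d ≥ 1`, where
`I^S = ∏ j, I_j ^ s_j` and `S_i` arises from `S` by lowering `s_i` by one. -/
def TightJointReductionEq {R : Type*} [CommRing R] (p : ℕ) [Fact p.Prime] [CharP R p] {d : ℕ}
    (a : Fin d → R) (I : Fin d → Ideal R) : Prop :=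
  ∀ s : Fin d → ℕ, (∀ i, 1 ≤ s i) →
    ∑ i, Ideal.span {a i} * tightClosure p (∏ j, I j ^ (Function.update s i (s i - 1) j)) =
      tightClosure p (∏ j, I j ^ s j)

/-- `∑_T (-1) ^ (d - #T) e_d^*(∏_{j ∈ T} I_j)`, over the nonempty subsets `T` of `{1, …, d}`. -/
def alternatingTightSum {R : Type*} [CommRing R] (p : ℕ) [Fact p.Prime] [CharP R p] {d : ℕ}
    (I : Fin d → Ideal R) : ℤ :=
  ∑ T ∈ Finset.univ.filter (fun T : Finset (Fin d) => T.Nonempty),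
    (-1) ^ (d - T.card) * lastTightHilbertCoeff p d (∏ j ∈ T, I j)

end

/-!
# Tight Hilbert coefficients and the Euler characteristic of Stanley–Reisner rings

All the conditions are compared with `χ(Δ) = 1`.

*Tight closures.* An ideal `I_j` generated by a linear system of parameters has the same image as
`𝔪` in the coordinate ring of every facet. Multiplying by the sum of the squarefree monomials of
the facets, which lies outside all minimal primes, this gives `𝔪 ^ |s| ≤ (∏ I_j ^ s_j)^*`; the
opposite inclusion follows by comparing orders on the facets. Hence tight closures of such products
are powers of `𝔪` (`tightClosure_prod_pow_eq`).

*The alternating sum.* Counting monomials by their support shows that the length of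
`R / 𝔪 ^ (t n)` is `∑_σ (t n - 1 choose |σ|)` over all faces `σ`, the empty one included. At `n = 0`
this polynomial has the value `∑_σ (-1) ^ |σ| = 1 - χ(Δ)` for every `t`, so that all the last
coefficients agree and their alternating sum is `χ(Δ) - 1` (`alternatingTightSum_eq`).

*Reductions.* The equations for `a_1, …, a_d` reduce to the single equation
`𝔪 ^ d = (a_1, …, a_d) 𝔪 ^ (d - 1)`. By Nakayama's lemma only the linear parts `b_i` of the `a_i`
matter. The notion that passes from one set of generators to another is `LinearPartsSpan`: the
linear parts have no nonzero common zero on the coordinate subspaces of the faces. It holds for the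
generators of any reduction of `𝔪` and, for linear forms, it implies that they generate a reduction.
As `R` is Cohen–Macaulay, the `b_i` form a regular sequence locally at `𝔪`
(`IsLocalRing.isRegular_of_forall_isPrime_eq_maximalIdeal`), and hence also on the graded ring, so
that `R / (b_1, …, b_d)` has the Hilbert series `∑_σ X^|σ| (1 - X)^(d - |σ|)`. The equation says
that its component of degree `d` vanishes, and the dimension of that component is
`(-1) ^ d * (1 - χ(Δ))` (`LinearPartsSpan.srMaxIdeal_pow_le_iff`).

*The reduction number.* An ideal generated by a linear system of parameters is a minimal reduction
of `𝔪`, because its generators restrict to a basis of the linear forms on a face with `d` vertices;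
so `χ(Δ) = 1` implies `r(𝔪) ≤ d - 1`. Conversely, over an infinite field a general choice of `d`
elements of a minimal reduction `J` satisfies `LinearPartsSpan`. Together with a high power of `𝔪`
these elements generate a reduction inside `J`, which is `J` by minimality, and Nakayama's lemma
leads back to `d` linear forms.
-/

noncomputable section

/-! ### Systems of parameters of Cohen–Macaulay local rings -/

/-- Coset prime avoidance: if no prime of a finite family contains both `y` and `I`, then some
element of `y + I` lies in none of them. -/
lemma Ideal.exists_add_notMem_of_finite_primes {A : Type*} [CommRing A] (s : Finset (Ideal A)) :
    ∀ (_ : ∀ P ∈ s, P.IsPrime) (I : Ideal A) (y : A) (_ : ∀ P ∈ s, y ∈ P → ¬ I ≤ P),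
      ∃ u ∈ I, ∀ P ∈ s, y + u ∉ P := by
  classical
  induction s using Finset.strongInduction with
  | H s ih =>
    intro hs I y hy
    rcases s.eq_empty_or_nonempty with rfl | hne
    · exact ⟨0, I.zero_mem, by simp⟩
    obtain ⟨Q, hQ⟩ := s.exists_minimal hne
    have hQs : Q ∈ s := hQ.1
    have hQp := hs Q hQs
    obtain ⟨u, hu, hus⟩ := ih (s.erase Q) (Finset.erase_ssubset hQs)
      (fun P hP => hs P (Finset.mem_of_mem_erase hP)) I y
      (fun P hP => hy P (Finset.mem_of_mem_erase hP))
    by_cases h : y + u ∈ Q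
    · -- correct `u` by an element of `I` lying in all the other primes but not in `Q`
      have hIQ : ¬ I ≤ Q := by
        intro hI
        have huQ : u ∈ Q := hI hu
        exact hy Q hQs ((Ideal.add_mem_iff_left Q huQ).1 h) hI
      have hprod : ¬ I * (s.erase Q).prod id ≤ Q := by
        rw [hQp.mul_le]
        rintro (h1 | h1)
        · exact hIQ h1
        · obtain ⟨P, hP, hPQ⟩ := hQp.prod_le.1 h1
          exact (Finset.mem_erase.1 hP).1
            (le_antisymm hPQ (hQ.2 (Finset.mem_of_mem_erase hP) hPQ))
      obtain ⟨w, hw, hwQ⟩ := SetLike.not_le_iff_exists.1 hprod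
      have hwI : w ∈ I := (Ideal.mul_le_left : I * (s.erase Q).prod id ≤ I) hw
      have hwprod : w ∈ (s.erase Q).prod id :=
        (Ideal.mul_le_right : I * (s.erase Q).prod id ≤ _) hw
      refine ⟨u + w, I.add_mem hu hwI, fun P hP hmem => ?_⟩
      rw [← add_assoc] at hmem
      by_cases hPQ : P = Q
      · subst hPQ
        exact hwQ ((P.add_mem_iff_right h).1 hmem)
      · have hP' : P ∈ s.erase Q := Finset.mem_erase.2 ⟨hPQ, hP⟩
        have hwP : w ∈ P :=
          (Ideal.prod_le_inf.trans (Finset.inf_le (f := id) hP')) hwprod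
        exact hus P hP' ((P.add_mem_iff_left hwP).1 hmem)
    · refine ⟨u, hu, fun P hP => ?_⟩
      by_cases hPQ : P = Q
      · rwa [hPQ]
      · exact hus P (Finset.mem_erase.2 ⟨hPQ, hP⟩)

open RingTheory.Sequence in
/-- If a finite module `M` over a Noetherian local ring has a regular sequence of length `d`, then
every sequence of `d` elements of the maximal ideal that generates an ideal of finite colength on
`M` is regular on `M`. The induction on `d` exchanges the elements of the two sequences: an element
of the coset `y + (ys)` is a nonzerodivisor modulo all but one of the elements of `xs`. -/
theorem IsLocalRing.isRegular_of_forall_isPrime_eq_maximalIdeal {A : Type*} [CommRing A]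
    [IsLocalRing A] [IsNoetherianRing A] (d : ℕ) :
    ∀ (M : Type*) [AddCommGroup M] [Module A M] [Module.Finite A M] (xs ys : List A),
      IsRegular M xs → xs.length = d → ys.length = d →
      (∀ y ∈ ys, y ∈ IsLocalRing.maximalIdeal A) →
      (∀ P : Ideal A, P.IsPrime → Ideal.ofList ys ≤ P → Module.annihilator A M ≤ P →
        P = IsLocalRing.maximalIdeal A) →
      IsRegular M ys := by
  induction d with
  | zero =>
    intro M _ _ _ xs ys hx hxl hyl _ _
    rw [List.length_eq_zero_iff] at hxl hyl
    rwa [hyl, ← hxl]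
  | succ d ih =>
    intro M _ _ _ xs ys hx hxl hyl hymem hfin
    have hMnt : Nontrivial M := hx.nontrivial
    have hxmem : ∀ x ∈ xs, x ∈ IsLocalRing.maximalIdeal A := fun x h6 => by
      refine IsLocalRing.le_maximalIdeal (J := Ideal.ofList xs) ?_ (Ideal.subset_span h6)
      exact hx.top_ne_smul ∘ Eq.trans (Submodule.top_smul _).symm ∘ Eq.symm ∘
        congrArg (· • (⊤ : Submodule A M))
    have hannle : ∀ z : A, Module.annihilator A M ≤ Module.annihilator A (QuotSMulTop z M) :=
      fun z => LinearMap.annihilator_le_of_surjective (Submodule.mkQ _) (Submodule.mkQ_surjective _)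
    have hzann : ∀ z : A, z ∈ Module.annihilator A (QuotSMulTop z M) := fun z => by
      rw [Module.mem_annihilator]
      intro m
      obtain ⟨m, rfl⟩ := Submodule.mkQ_surjective _ m
      rw [← map_smul, Submodule.mkQ_apply, Submodule.Quotient.mk_eq_zero]
      exact Submodule.smul_mem_pointwise_smul _ _ _ trivial
    -- after a change of the first element modulo the others, the sequence is regular
    have key : ∀ (y : A) (ys0 : List A), ys0.length = d → (y :: ys0).Perm ys →
        ∃ u ∈ Ideal.ofList ys0, IsRegular M ((y + u) :: ys0) := by
      intro y ys0 hl0 hperm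
      obtain ⟨x, xs', rfl⟩ : ∃ x xs', xs = x :: xs' :=
        List.exists_cons_of_length_eq_add_one hxl
      have hperm' : (x :: xs').Perm (xs' ++ [x]) := by
        simpa using (List.perm_append_comm (l₁ := [x]) (l₂ := xs'))
      have hx' := IsLocalRing.isRegular_of_perm hx hperm'
      have hsplit := (isWeaklyRegular_append_iff M xs' [x]).1 hx'.toIsWeaklyRegular
      set N := M ⧸ (Ideal.ofList xs' • ⊤ : Submodule A M) with hN
      have hxN : IsSMulRegular N x := (isWeaklyRegular_singleton_iff _ _).1 hsplit.2
      have hass := biUnion_associatedPrimes_eq_compl_regular A N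
      have hmem_iff : ∀ r : A, (∃ Q ∈ associatedPrimes A N, r ∈ Q) ↔ ¬ IsSMulRegular N r := by
        intro r
        have := Set.ext_iff.1 hass r
        simpa using this
      have hfinite := associatedPrimes.finite A N
      have hofl : Ideal.ofList (y :: ys0) = Ideal.ofList ys := by
        unfold Ideal.ofList
        congr 1
        ext r
        exact hperm.mem_iff
      obtain ⟨u, hu, hus⟩ := Ideal.exists_add_notMem_of_finite_primes hfinite.toFinset
        (fun P hP => ((hfinite.mem_toFinset).1 hP).1) (Ideal.ofList ys0) y (by
          intro P hP hyP hle
          have hP' := (hfinite.mem_toFinset).1 hP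
          have hPm : P = IsLocalRing.maximalIdeal A := by
            refine hfin P hP'.1 ?_ ?_
            · rw [← hofl, Ideal.ofList_cons]
              exact sup_le ((Ideal.span_singleton_le_iff_mem _).2 hyP) hle
            · refine le_trans ?_ (IsAssociatedPrime.annihilator_le hP')
              rw [Submodule.annihilator_top]
              exact LinearMap.annihilator_le_of_surjective
                (Submodule.mkQ (Ideal.ofList xs' • ⊤ : Submodule A M)) (Submodule.mkQ_surjective _)
          exact (hmem_iff x).1 ⟨P, hP', hPm ▸ hxmem x (by simp)⟩ hxN)
      refine ⟨u, hu, ?_⟩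
      have hzN : IsSMulRegular N (y + u) := by
        by_contra hcon
        obtain ⟨Q, hQ, hzQ⟩ := (hmem_iff _).2 hcon
        exact hus Q ((hfinite.mem_toFinset).2 hQ) hzQ
      have hymem' : ∀ r ∈ y :: ys0, r ∈ IsLocalRing.maximalIdeal A :=
        fun r hr => hymem r (hperm.mem_iff.1 hr)
      have humem : u ∈ IsLocalRing.maximalIdeal A :=
        (Ideal.span_le.2 fun r hr => hymem' r (List.mem_cons_of_mem _ hr) :
          Ideal.ofList ys0 ≤ IsLocalRing.maximalIdeal A) hu
      have hzmem : y + u ∈ IsLocalRing.maximalIdeal A :=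
        Ideal.add_mem _ (hymem' y (by simp)) humem
      have hreg1 : IsRegular M (xs' ++ [y + u]) :=
        IsRegular.of_isWeaklyRegular_of_mem_maximalIdeal M (by
          intro r hr
          rcases List.mem_append.1 hr with hr | hr
          · exact hxmem r (List.mem_cons_of_mem _ hr)
          · rw [List.mem_singleton.1 hr]; exact hzmem)
          ((isWeaklyRegular_append_iff M xs' [y + u]).2
            ⟨hsplit.1, (isWeaklyRegular_singleton_iff _ _).2 hzN⟩)
      have hreg2 : IsRegular M ((y + u) :: xs') :=
        IsLocalRing.isRegular_of_perm hreg1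
          (List.perm_append_comm (l₁ := xs') (l₂ := [y + u]))
      rw [isRegular_cons_iff] at hreg2 ⊢
      refine ⟨hreg2.1, ih _ xs' ys0 hreg2.2 (by simpa using hxl) hl0
        (fun r hr => hymem' r (List.mem_cons_of_mem _ hr)) fun P hP hle hann => ?_⟩
      refine hfin P hP ?_ ((hannle _).trans hann)
      rw [← hofl, Ideal.ofList_cons]
      refine sup_le ((Ideal.span_singleton_le_iff_mem _).2 ?_) hle
      exact (P.add_mem_iff_left (hle hu)).1 (hann (hzann (y + u)))
    obtain ⟨y1, ys', rfl⟩ : ∃ y ys', ys = y :: ys' :=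
      List.exists_cons_of_length_eq_add_one hyl
    rcases ys' with _ | ⟨y2, ys''⟩
    · obtain ⟨u, hu, hreg⟩ := key y1 [] (Nat.succ_injective hyl) (List.Perm.refl _)
      rw [Ideal.ofList_nil, Ideal.mem_bot] at hu
      simpa [hu] using hreg
    · obtain ⟨u, hu, hreg⟩ := key y2 (y1 :: ys'') (by simpa using hyl) (List.Perm.swap _ _ _)
      have hreg' := IsLocalRing.isRegular_of_perm hreg (List.Perm.swap _ _ _)
      rw [isRegular_cons_iff] at hreg' ⊢
      refine ⟨hreg'.1, ih _ _ (y2 :: ys'') hreg'.2 (by simpa using hyl) (by simpa using hyl)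
        (fun r hr => hymem r (List.mem_cons_of_mem _ hr)) fun P hP hle hann => ?_⟩
      refine hfin P hP ?_ ((hannle _).trans hann)
      rw [Ideal.ofList_cons]
      exact sup_le ((Ideal.span_singleton_le_iff_mem _).2 (hann (hzann y1))) hle

/-! ### Numerical polynomials -/

section Numerical

open Polynomial

lemma Polynomial.natDegree_sub_comp_X_sub_one_le (Q : ℚ[X]) (d : ℕ) (hQ : Q.natDegree ≤ d + 1) :
    (Q - Q.comp (X - 1)).natDegree ≤ d := by
  have h1 : (X - 1 : ℚ[X]).natDegree = 1 := by simpa using natDegree_X_sub_C (1 : ℚ)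
  have h2 : (X - 1 : ℚ[X]).leadingCoeff = 1 := by simpa using leadingCoeff_X_sub_C (1 : ℚ)
  have hnd : (Q.comp (X - 1)).natDegree = Q.natDegree := by rw [natDegree_comp, h1, mul_one]
  have hle : (Q - Q.comp (X - 1)).natDegree ≤ d + 1 :=
    (natDegree_sub_le _ _).trans (by simp [hnd, hQ])
  refine natDegree_le_of_degree_le ?_
  rw [degree_le_iff_coeff_zero]
  intro m hm
  have hm' : d < m := by exact_mod_cast hm
  rcases Nat.lt_or_ge (d + 1) m with h | h
  · exact coeff_eq_zero_of_natDegree_lt (hle.trans_lt h)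
  · have hmd : m = d + 1 := by omega
    subst hmd
    rcases hQ.lt_or_eq with hlt | heq
    · rw [coeff_sub, coeff_eq_zero_of_natDegree_lt hlt,
        coeff_eq_zero_of_natDegree_lt (hnd ▸ hlt), sub_zero]
    · have hl : (Q.comp (X - 1)).coeff (d + 1) = Q.coeff (d + 1) := by
        conv_lhs => rw [← heq, ← hnd]
        rw [coeff_natDegree, leadingCoeff_comp (by rw [h1]; exact one_ne_zero), h2, one_pow,
          mul_one, leadingCoeff, heq]
      rw [coeff_sub, hl, sub_self]

/-- A polynomial of degree at most `d` with integer values at the integers is an integral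
combination of the polynomials `(n + j - 1 choose j)`, `j ≤ d`. -/
lemma Polynomial.exists_int_coeff_choose (d : ℕ) : ∀ (Q : ℚ[X]), Q.natDegree ≤ d →
    (∀ z : ℤ, ∃ w : ℤ, Q.eval (z : ℚ) = w) →
    ∃ c : ℕ → ℤ, ∀ n : ℕ, Q.eval (n : ℚ) =
      ∑ j ∈ Finset.range (d + 1), (c j : ℚ) * ((n + j - 1).choose j : ℚ) := by
  induction d with
  | zero =>
    intro Q hQ hint
    obtain ⟨w, hw⟩ := hint 0
    refine ⟨fun _ => w, fun n => ?_⟩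
    rw [eq_C_of_natDegree_le_zero hQ] at hw ⊢
    simpa using hw
  | succ d ih =>
    intro Q hQ hint
    obtain ⟨c, hc⟩ := ih (Q - Q.comp (X - 1)) (Q.natDegree_sub_comp_X_sub_one_le d hQ) (by
      intro z
      obtain ⟨w, hw⟩ := hint z
      obtain ⟨w', hw'⟩ := hint (z - 1)
      refine ⟨w - w', ?_⟩
      push_cast at hw' ⊢
      simp [hw, hw'])
    obtain ⟨w, hw⟩ := hint 0
    refine ⟨fun j => j.casesOn w c, fun n => ?_⟩
    induction n with
    | zero =>
      rw [Finset.sum_range_succ', Finset.sum_eq_zero]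
      · simpa using hw
      · intro j _
        simp
    | succ n ihn =>
      have hstep : Q.eval ((n + 1 : ℕ) : ℚ) =
          Q.eval (n : ℚ) + (Q - Q.comp (X - 1)).eval ((n + 1 : ℕ) : ℚ) := by
        simp
      rw [hstep, hc, ihn, Finset.sum_range_succ', Finset.sum_range_succ' _ (d + 1), add_right_comm,
        ← Finset.sum_add_distrib]
      congr 1
      · refine Finset.sum_congr rfl fun j _ => ?_
        have e1 : n + (j + 1) - 1 = n + j := by omega
        have e2 : n + 1 + j - 1 = n + j := by omega
        have e3 : n + 1 + (j + 1) - 1 = n + j + 1 := by omega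
        rw [e1, e2, e3, Nat.choose_succ_succ]
        push_cast
        ring
      · simp

lemma Polynomial.eval_ascPochhammer_div_factorial (n j : ℕ) :
    (ascPochhammer ℚ j).eval (n : ℚ) / (j.factorial : ℚ) = ((n + j - 1).choose j : ℚ) := by
  rw [Nat.cast_choose_eq_ascPochhammer_div]
  rcases j with _ | j
  · simp
  · congr 3
    omega

/-- The value at `0` of a polynomial can be read off its coefficients with respect to the
polynomials `(n + j - 1 choose j)`, all of which but the one for `j = 0` vanish at `0`. -/
lemma Polynomial.eval_zero_eq_of_eventually_eq (d : ℕ) (Q : ℚ[X]) (c : ℕ → ℤ)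
    (h : ∀ᶠ n : ℕ in atTop, Q.eval (n : ℚ) =
      ∑ j ∈ Finset.range (d + 1), (c j : ℚ) * ((n + j - 1).choose j : ℚ)) :
    Q.eval 0 = c 0 := by
  set P : ℚ[X] := ∑ j ∈ Finset.range (d + 1),
    C ((c j : ℚ) / (j.factorial : ℚ)) * ascPochhammer ℚ j with hP
  have hQP : Q = P := by
    refine eq_of_infinite_eval_eq Q P ?_
    obtain ⟨N, hN⟩ := eventually_atTop.1 h
    refine Set.Infinite.mono (s := (fun n : ℕ => (n : ℚ)) '' Set.Ici N) ?_
      ((Set.Ici_infinite N).image Nat.cast_injective.injOn)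
    rintro _ ⟨n, hn, rfl⟩
    simp only [Set.mem_ofPred_eq, hN n hn, hP, eval_finsetSum, eval_mul, eval_C]
    refine Finset.sum_congr rfl fun j _ => ?_
    rw [← eval_ascPochhammer_div_factorial]
    ring
  rw [hQP, hP, eval_finsetSum, Finset.sum_range_succ', Finset.sum_eq_zero]
  · simp
  · intro j _
    simp

/-- The polynomial in `n` with values `(t * n - 1 choose s)`. -/
def Polynomial.chooseMulSubOne (t s : ℕ) : ℚ[X] :=
  C ((s.factorial : ℚ)⁻¹) * (descPochhammer ℚ s).comp (C (t : ℚ) * X - 1)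

lemma Polynomial.natDegree_chooseMulSubOne_le (t s : ℕ) :
    (chooseMulSubOne t s).natDegree ≤ s := by
  refine (natDegree_C_mul_le _ _).trans ?_
  refine (natDegree_comp_le).trans ?_
  rw [descPochhammer_natDegree]
  have : (C (t : ℚ) * X - 1 : ℚ[X]).natDegree ≤ 1 := by compute_degree
  simpa using Nat.mul_le_mul_left s this

lemma Polynomial.eval_chooseMulSubOne_int (t s : ℕ) (z : ℤ) :
    (chooseMulSubOne t s).eval (z : ℚ) = (Ring.choose ((t : ℤ) * z - 1) s : ℤ) := by
  have h := Ring.descPochhammer_eq_factorial_smul_choose ((t : ℤ) * z - 1) s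
  rw [← eval_eq_smeval] at h
  have h2 : (descPochhammer ℚ s).eval ((t : ℚ) * z - 1) =
      (((descPochhammer ℤ s).eval ((t : ℤ) * z - 1) : ℤ) : ℚ) := by
    have := descPochhammer_eval_cast s ((t : ℤ) * z - 1) (R := ℚ)
    push_cast at this ⊢
    exact this.symm
  have hs : (s.factorial : ℚ) ≠ 0 := by exact_mod_cast s.factorial_ne_zero
  simp only [chooseMulSubOne, eval_mul, eval_C, eval_comp, eval_sub, eval_X, eval_one]
  rw [h2, h]
  simp
  field_simp

lemma Polynomial.eval_chooseMulSubOne (t s n : ℕ) (ht : 1 ≤ t) (hn : 1 ≤ n) :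
    (chooseMulSubOne t s).eval (n : ℚ) = ((t * n - 1).choose s : ℚ) := by
  have h := eval_chooseMulSubOne_int t s n
  have h1 : 1 ≤ t * n := Nat.mul_pos ht hn
  have h2 : ((t : ℤ) * (n : ℤ) - 1) = ((t * n - 1 : ℕ) : ℤ) := by
    push_cast [h1]; ring
  rw [h2, Ring.choose_natCast] at h
  exact_mod_cast h

lemma Polynomial.eval_zero_chooseMulSubOne (t s : ℕ) :
    (chooseMulSubOne t s).eval 0 = (-1) ^ s := by
  have h := eval_chooseMulSubOne_int t s 0
  have h2 : Ring.choose (-1 : ℤ) s = (-1) ^ s := by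
    rw [Ring.choose_neg', Ring.multichoose_one]
    simp [Units.smul_def, Int.negOnePow_def]
  simpa [h2] using h

end Numerical

/-! ### Counting monomials by their support -/

section Counting

variable {V : Type*} [DecidableEq V]

/-- The exponents of total degree `n` whose support is exactly `σ`. -/
def exponentsOn (σ : Finset V) (n : ℕ) : Finset (V →₀ ℕ) :=
  (σ.finsuppAntidiag n).filter fun m => m.support = σ

lemma mem_exponentsOn {σ : Finset V} {n : ℕ} {m : V →₀ ℕ} :
    m ∈ exponentsOn σ n ↔ m.support = σ ∧ m.degree = n := by
  rw [exponentsOn, Finset.mem_filter, Finset.mem_finsuppAntidiag]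
  constructor
  · rintro ⟨⟨h1, h2⟩, rfl⟩
    exact ⟨rfl, h1⟩
  · rintro ⟨rfl, h2⟩
    exact ⟨⟨h2, subset_rfl⟩, rfl⟩

lemma card_exponentsOn_empty (n : ℕ) :
    (exponentsOn (∅ : Finset V) n).card = if n = 0 then 1 else 0 := by
  split_ifs with h
  · rw [Finset.card_eq_one]
    refine ⟨0, ?_⟩
    ext m
    rw [mem_exponentsOn, Finset.mem_singleton, Finsupp.support_eq_empty]
    constructor
    · exact fun h => h.1
    · rintro rfl; simp [h]
  · rw [Finset.card_eq_zero, Finset.eq_empty_iff_forall_notMem]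
    intro m hm
    rw [mem_exponentsOn, Finsupp.support_eq_empty] at hm
    obtain ⟨rfl, h0⟩ := hm
    exact h (by simpa using h0.symm)

lemma card_exponentsOn_insert_zero {σ : Finset V} {a : V} :
    (exponentsOn (insert a σ) 0).card = 0 := by
  rw [Finset.card_eq_zero, Finset.eq_empty_iff_forall_notMem]
  intro m hm
  rw [mem_exponentsOn, Finsupp.degree_eq_zero_iff] at hm
  obtain ⟨h0, rfl⟩ := hm
  exact (Finset.insert_ne_empty a σ) h0.symm

/-- Dividing by the variable `a` leaves the support unchanged or removes `a` from it. -/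
lemma card_exponentsOn_insert_succ {σ : Finset V} {a : V} (ha : a ∉ σ) (n : ℕ) :
    (exponentsOn (insert a σ) (n + 1)).card =
      (exponentsOn (insert a σ) n).card + (exponentsOn σ n).card := by
  have hdisj : Disjoint (exponentsOn (insert a σ) n) (exponentsOn σ n) := by
    rw [Finset.disjoint_left]
    intro m h1 h2
    rw [mem_exponentsOn] at h1 h2
    exact ha (by rw [← h2.1, h1.1]; simp)
  rw [← Finset.card_union_of_disjoint hdisj,
    ← Finset.card_map (s := exponentsOn (insert a σ) n ∪ exponentsOn σ n)
      (addRightEmbedding (Finsupp.single a 1))]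
  congr 1
  ext m
  rw [Finset.mem_map, mem_exponentsOn]
  constructor
  · rintro ⟨hs, hd⟩
    have ham : 1 ≤ m a := by
      have : a ∈ m.support := by rw [hs]; simp
      exact Nat.one_le_iff_ne_zero.2 (Finsupp.mem_support_iff.1 this)
    have hle : Finsupp.single a 1 ≤ m := Finsupp.single_le_iff.2 ham
    obtain ⟨m', rfl⟩ := le_iff_exists_add'.1 hle
    refine ⟨m', ?_, rfl⟩
    have hdeg : m'.degree = n := by
      rw [map_add, Finsupp.degree_single] at hd
      omega
    have hsupp : ∀ b, b ≠ a → (m' b ≠ 0 ↔ b ∈ σ) := by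
      intro b hb
      have : b ∈ (m' + Finsupp.single a 1).support ↔ b ∈ insert a σ := by rw [hs]
      rw [Finsupp.mem_support_iff, Finset.mem_insert] at this
      simpa [Finsupp.single_apply, hb, hb.symm] using this
    rw [Finset.mem_union, mem_exponentsOn, mem_exponentsOn]
    by_cases h : m' a = 0
    · right
      refine ⟨?_, hdeg⟩
      ext b
      rw [Finsupp.mem_support_iff]
      by_cases hb : b = a
      · subst hb; simp only [h, ha, ne_eq, not_true]
      · exact hsupp b hb
    · left
      refine ⟨?_, hdeg⟩
      ext b
      rw [Finsupp.mem_support_iff, Finset.mem_insert]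
      by_cases hb : b = a
      · subst hb; simp only [h, true_or, ne_eq, not_false_eq_true]
      · simp only [hsupp b hb, hb, false_or]
  · rintro ⟨m, hm, rfl⟩
    rw [Finset.mem_union, mem_exponentsOn, mem_exponentsOn] at hm
    simp only [addRightEmbedding_apply]
    have hsup : (m + Finsupp.single a 1).support = insert a m.support := by
      ext b
      simp only [Finsupp.mem_support_iff, Finsupp.add_apply, Finset.mem_insert,
        Finsupp.single_apply]
      by_cases hb : a = b
      · simp [hb]
      · simp [hb, Ne.symm hb]
    rcases hm with ⟨hs, hd⟩ | ⟨hs, hd⟩ <;> rw [hsup, hs, map_add, hd] <;> simp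

lemma sum_card_exponentsOn (σ : Finset V) (N : ℕ) :
    ∑ n ∈ Finset.range (N + 1), (exponentsOn σ n).card = N.choose σ.card := by
  induction σ using Finset.induction_on generalizing N with
  | empty => simp [card_exponentsOn_empty]
  | insert a σ ha ih =>
    rw [Finset.card_insert_of_notMem ha]
    induction N with
    | zero => simp [card_exponentsOn_insert_zero]
    | succ N ihN =>
      have key : ∑ n ∈ Finset.range (N + 1), (exponentsOn (insert a σ) (n + 1)).card =
          N.choose (σ.card + 1) + N.choose σ.card := by
        rw [Finset.sum_congr rfl fun n _ => card_exponentsOn_insert_succ ha n,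
          Finset.sum_add_distrib, ihN, ih]
      rw [Finset.sum_range_succ', key, card_exponentsOn_insert_zero, Nat.choose_succ_succ',
        add_zero, add_comm]

open PowerSeries in
/-- The generating function of the monomials with support `σ` is `(X / (1 - X)) ^ #σ`. -/
lemma one_sub_X_pow_mul_mk_card_exponentsOn (σ : Finset V) :
    (1 - X : PowerSeries ℤ) ^ σ.card * PowerSeries.mk (fun n => ((exponentsOn σ n).card : ℤ)) =
      X ^ σ.card := by
  induction σ using Finset.induction_on with
  | empty =>
    ext n
    simp [card_exponentsOn_empty, coeff_one]
  | insert a σ ha ih =>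
    have h : (1 - X : PowerSeries ℤ) *
        PowerSeries.mk (fun n => ((exponentsOn (insert a σ) n).card : ℤ)) =
          X * PowerSeries.mk (fun n => ((exponentsOn σ n).card : ℤ)) := by
      ext n
      rw [sub_mul, one_mul, map_sub]
      rcases n with _ | n
      · simp [card_exponentsOn_insert_zero]
      · rw [coeff_succ_X_mul, coeff_succ_X_mul, coeff_mk, coeff_mk, coeff_mk,
          card_exponentsOn_insert_succ ha]
        push_cast; ring
    rw [Finset.card_insert_of_notMem ha, pow_succ, mul_assoc, h, mul_left_comm, ih, pow_succ']

open PowerSeries in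
lemma coeff_X_pow_mul_one_sub_X_pow {s d : ℕ} (h : s ≤ d) :
    coeff d (X ^ s * (1 - X : PowerSeries ℤ) ^ (d - s)) = (-1) ^ (d - s) := by
  have h1 : coeff d (X ^ s * (1 - X : PowerSeries ℤ) ^ (d - s)) =
      coeff (d - s) ((1 - X : PowerSeries ℤ) ^ (d - s)) := by
    conv_lhs => rw [show d = (d - s) + s by omega]
    rw [coeff_X_pow_mul]
    simp
  rw [h1]
  generalize d - s = m
  have h2 : (1 - X : PowerSeries ℤ) ^ m =
      (((-1) ^ m * (Polynomial.X - Polynomial.C 1) ^ m : Polynomial ℤ) : PowerSeries ℤ) := by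
    rw [← mul_pow]
    simp
  rw [h2, Polynomial.coeff_coe]
  have h3 : ((-1 : Polynomial ℤ)) ^ m = Polynomial.C ((-1) ^ m) := by simp
  have h4 := (Polynomial.monic_X_sub_C (1 : ℤ)).pow m
  have h5 := h4.coeff_natDegree
  rw [(Polynomial.monic_X_sub_C (1 : ℤ)).natDegree_pow, Polynomial.natDegree_X_sub_C, mul_one] at h5
  rw [h3, Polynomial.coeff_C_mul, h5, mul_one]

end Counting

/-! ### Powers of an ideal modulo a product of ideals -/

/-- Modulo `J`, each factor `M` of a power of `M` can be replaced by one of the `P i`. -/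
lemma Ideal.pow_card_succ_le_of_forall_le_sup {R ι : Type*} [CommRing R] (M J : Ideal R)
    (P : ι → Ideal R) (A : Finset ι) (hP : ∀ i ∈ A, P i ≤ M) (h : ∀ i ∈ A, M ≤ J ⊔ P i) :
    M ^ (A.card + 1) ≤ J * M ^ A.card ⊔ M * ∏ i ∈ A, P i := by
  classical
  induction A using Finset.induction_on with
  | empty => simp
  | insert a A ha ih =>
    rw [Finset.card_insert_of_notMem ha, Finset.prod_insert ha]
    have h1 := ih (fun i hi => hP i (Finset.mem_insert_of_mem hi))
      (fun i hi => h i (Finset.mem_insert_of_mem hi))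
    have h2 := h a (Finset.mem_insert_self _ _)
    have hprod : ∏ i ∈ A, P i ≤ M ^ A.card := by
      rw [← Finset.prod_const]
      exact Finset.prod_le_prod' fun i hi => hP i (Finset.mem_insert_of_mem hi)
    calc M ^ (A.card + 1 + 1) = M * M ^ (A.card + 1) := pow_succ' _ _
      _ ≤ M * (J * M ^ A.card ⊔ M * ∏ i ∈ A, P i) := Ideal.mul_mono_right h1
      _ = J * M ^ (A.card + 1) ⊔ M * (M * ∏ i ∈ A, P i) := by
          rw [Ideal.mul_sup, pow_succ' M, mul_left_comm]
      _ ≤ J * M ^ (A.card + 1) ⊔ M * ((J ⊔ P a) * ∏ i ∈ A, P i) :=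
          sup_le_sup_left (Ideal.mul_mono_right (Ideal.mul_mono_left h2)) _
      _ = J * M ^ (A.card + 1) ⊔ (J * (M * ∏ i ∈ A, P i) ⊔ M * (P a * ∏ i ∈ A, P i)) := by
          rw [Ideal.sup_mul, Ideal.mul_sup, mul_left_comm M J]
      _ ≤ _ := by
          rw [← sup_assoc]
          refine sup_le_sup_right (sup_le le_rfl (Ideal.mul_mono_right ?_)) _
          rw [pow_succ']
          exact Ideal.mul_mono_right hprod

/-! ### Monomials and coordinate subspaces of Stanley–Reisner rings -/

section StanleyReisnerBasics

variable {k : Type*} [Field k] {V : Type*} {Δ : AbstractSimplicialComplex V}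

/-- `σ` is a face of `Δ`, where the empty set counts as a face. -/
def IsFaceOrEmpty (Δ : AbstractSimplicialComplex V) (σ : Finset V) : Prop :=
  σ = ∅ ∨ σ ∈ Δ.faces

lemma IsFaceOrEmpty.mono {σ τ : Finset V} (h : IsFaceOrEmpty Δ σ) (hτ : τ ⊆ σ) :
    IsFaceOrEmpty Δ τ := by
  rcases τ.eq_empty_or_nonempty with rfl | hne
  · exact Or.inl rfl
  · rcases h with rfl | h
    · exact absurd (Finset.subset_empty.1 hτ) hne.ne_empty
    · exact Or.inr ((Δ.isRelLowerSet_faces h).2 hτ hne)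

lemma mem_stanleyReisnerIdeal_iff {f : MvPolynomial V k} :
    f ∈ stanleyReisnerIdeal k Δ ↔ ∀ m ∈ f.support, ¬ IsFaceOrEmpty Δ m.support := by
  classical
  have heq : stanleyReisnerIdeal k Δ = Ideal.span ((fun m => MvPolynomial.monomial m (1 : k)) ''
      {m : V →₀ ℕ | ∃ σ : Finset V, σ.Nonempty ∧ σ ∉ Δ.faces ∧
        m = ∑ i ∈ σ, Finsupp.single i 1}) := by
    unfold stanleyReisnerIdeal
    congr 1
    ext f
    constructor
    · rintro ⟨σ, h1, h2, rfl⟩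
      exact ⟨_, ⟨σ, h1, h2, rfl⟩, by simp [MvPolynomial.X, MvPolynomial.monomial_sum_one]⟩
    · rintro ⟨m, ⟨σ, h1, h2, rfl⟩, rfl⟩
      exact ⟨σ, h1, h2, by simp [MvPolynomial.X, MvPolynomial.monomial_sum_one]⟩
  rw [heq, MvPolynomial.mem_ideal_span_monomial_image]
  refine forall₂_congr fun m _ => ?_
  have happ : ∀ (σ : Finset V) (i : V),
      (∑ j ∈ σ, Finsupp.single j 1 : V →₀ ℕ) i = if i ∈ σ then 1 else 0 := by
    intro σ i
    rw [Finsupp.finsetSum_apply]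
    simp [Finsupp.single_apply]
  constructor
  · rintro ⟨_, ⟨σ, h1, h2, rfl⟩, hle⟩ hface
    have hsub : σ ⊆ m.support := by
      intro i hi
      have := hle i
      rw [happ, if_pos hi] at this
      exact Finsupp.mem_support_iff.2 (by omega)
    rcases hface.mono hsub with h | h
    · exact h1.ne_empty h
    · exact h2 h
  · intro h
    simp only [IsFaceOrEmpty, not_or] at h
    refine ⟨_, ⟨m.support, Finset.nonempty_iff_ne_empty.2 h.1, h.2, rfl⟩, fun i => ?_⟩
    rw [happ]
    split_ifs with hi
    · exact Nat.one_le_iff_ne_zero.2 (Finsupp.mem_support_iff.1 hi)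
    · exact Nat.zero_le _

lemma srMaxIdeal_eq_map : srMaxIdeal k Δ =
    (MvPolynomial.idealOfVars V k).map (Ideal.Quotient.mk (stanleyReisnerIdeal k Δ)) := by
  rw [srMaxIdeal, MvPolynomial.idealOfVars, Ideal.map_span, ← Set.range_comp]
  rfl

lemma srVar_mem_srMaxIdeal (i : V) : srVar k Δ i ∈ srMaxIdeal k Δ :=
  Ideal.subset_span ⟨i, rfl⟩

lemma mk_mem_srMaxIdeal_pow_iff {n : ℕ} {f : MvPolynomial V k} :
    Ideal.Quotient.mk (stanleyReisnerIdeal k Δ) f ∈ srMaxIdeal k Δ ^ n ↔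
      ∀ m ∈ f.support, IsFaceOrEmpty Δ m.support → n ≤ m.degree := by
  rw [srMaxIdeal_eq_map, ← Ideal.map_pow, Ideal.mem_map_iff_of_surjective _
    Ideal.Quotient.mk_surjective]
  constructor
  · rintro ⟨g, hg, hfg⟩ m hm hface
    rw [Ideal.Quotient.eq, mem_stanleyReisnerIdeal_iff] at hfg
    have h0 : (g - f).coeff m = 0 := by
      by_contra h
      exact hfg m (MvPolynomial.mem_support_iff.2 h) hface
    rw [MvPolynomial.coeff_sub, sub_eq_zero] at h0
    exact (MvPolynomial.mem_pow_idealOfVars_iff n g).1 hg m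
      (MvPolynomial.mem_support_iff.2 (h0 ▸ MvPolynomial.mem_support_iff.1 hm))
  · intro h
    have hf : f ∈ MvPolynomial.idealOfVars V k ^ n ⊔ stanleyReisnerIdeal k Δ := by
      rw [f.as_sum]
      refine Ideal.sum_mem _ fun m hm => ?_
      by_cases hface : IsFaceOrEmpty Δ m.support
      · exact Ideal.mem_sup_left ((MvPolynomial.monomial_mem_pow_idealOfVars_iff n m
          (MvPolynomial.mem_support_iff.1 hm)).2 (h m hm hface))
      · refine Ideal.mem_sup_right (mem_stanleyReisnerIdeal_iff.2 fun m' hm' => ?_)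
        rwa [Finset.mem_singleton.1 (MvPolynomial.support_monomial_subset hm')]
    obtain ⟨g, hg, g', hg', rfl⟩ := Submodule.mem_sup.1 hf
    refine ⟨g, hg, ?_⟩
    rw [map_add, Ideal.Quotient.eq_zero_iff_mem.2 hg', add_zero]

variable (k) in
open Classical in
/-- The endomorphism of the polynomial ring that restricts polynomials to the coordinate subspace
`k ^ σ`: the variables outside `σ` are sent to `0`. -/
def restrictVars (σ : Finset V) : MvPolynomial V k →ₐ[k] MvPolynomial V k :=
  MvPolynomial.aeval fun i => if i ∈ σ then MvPolynomial.X i else 0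

open Classical in
lemma coeff_restrictVars (σ : Finset V) (f : MvPolynomial V k) (m : V →₀ ℕ) :
    (restrictVars k σ f).coeff m = if m.support ⊆ σ then f.coeff m else 0 := by
  induction f using MvPolynomial.induction_on' with
  | monomial n c =>
    have hmon : restrictVars k σ (MvPolynomial.monomial n c) =
        if n.support ⊆ σ then MvPolynomial.monomial n c else 0 := by
      rw [restrictVars, MvPolynomial.aeval_monomial, Finsupp.prod]
      split_ifs with h
      · rw [MvPolynomial.monomial_eq, Finsupp.prod]
        congr 1
        exact Finset.prod_congr rfl fun i hi => by rw [if_pos (h hi)]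
      · obtain ⟨i, hi, hiσ⟩ := Finset.not_subset.1 h
        rw [Finset.prod_eq_zero hi, mul_zero]
        rw [if_neg hiσ, zero_pow (Finsupp.mem_support_iff.1 hi)]
    rw [hmon]
    by_cases hnm : n = m
    · subst hnm
      split_ifs <;> simp
    · split_ifs <;> simp [MvPolynomial.coeff_monomial, hnm]
  | add p q hp hq =>
    rw [map_add, MvPolynomial.coeff_add, hp, hq, MvPolynomial.coeff_add]
    split_ifs <;> simp

variable (k) in
/-- Restriction of the elements of `k[Δ]` to the coordinate subspace of the face `σ`. Its kernel is
the prime ideal generated by the variables outside `σ`. -/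
def faceMap {σ : Finset V} (h : IsFaceOrEmpty Δ σ) :
    StanleyReisnerRing k Δ →ₐ[k] MvPolynomial V k :=
  Ideal.Quotient.liftₐ _ (restrictVars k σ) fun f hf => by
    classical
    ext m
    rw [coeff_restrictVars, MvPolynomial.coeff_zero]
    split_ifs with hm
    · by_contra h0
      exact mem_stanleyReisnerIdeal_iff.1 hf m (MvPolynomial.mem_support_iff.2 h0) (h.mono hm)
    · rfl

lemma faceMap_mk {σ : Finset V} (h : IsFaceOrEmpty Δ σ) (f : MvPolynomial V k) :
    faceMap k h (Ideal.Quotient.mk _ f) = restrictVars k σ f := rfl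

open Classical in
lemma faceMap_srVar {σ : Finset V} (h : IsFaceOrEmpty Δ σ) (i : V) :
    faceMap k h (srVar k Δ i) = if i ∈ σ then MvPolynomial.X i else 0 := by
  rw [srVar, faceMap_mk, restrictVars, MvPolynomial.aeval_X]

/-- An element of `k[Δ]` has order at least `n` if its restrictions to all faces do. -/
lemma mem_srMaxIdeal_pow_of_faceMap {n : ℕ} {r : StanleyReisnerRing k Δ}
    (hr : ∀ (σ : Finset V) (h : IsFaceOrEmpty Δ σ) (m : V →₀ ℕ), m.degree < n →
      (faceMap k h r).coeff m = 0) : r ∈ srMaxIdeal k Δ ^ n := by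
  classical
  obtain ⟨f, rfl⟩ := Ideal.Quotient.mk_surjective r
  rw [mk_mem_srMaxIdeal_pow_iff]
  intro m hm hface
  by_contra hlt
  have := hr m.support hface m (not_le.1 hlt)
  rw [faceMap_mk, coeff_restrictVars, if_pos subset_rfl] at this
  exact MvPolynomial.mem_support_iff.1 hm this

lemma eq_zero_of_faceMap {r : StanleyReisnerRing k Δ}
    (hr : ∀ (σ : Finset V) (h : IsFaceOrEmpty Δ σ), faceMap k h r = 0) : r = 0 := by
  classical
  obtain ⟨f, rfl⟩ := Ideal.Quotient.mk_surjective r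
  rw [Ideal.Quotient.eq_zero_iff_mem, mem_stanleyReisnerIdeal_iff]
  intro m hm hface
  have := congrArg (MvPolynomial.coeff m) (hr m.support hface)
  rw [faceMap_mk, coeff_restrictVars, if_pos subset_rfl, MvPolynomial.coeff_zero] at this
  exact MvPolynomial.mem_support_iff.1 hm this

variable (k Δ) in
/-- The ideal of `k[Δ]` generated by the variables outside `σ`. -/
def faceIdeal (σ : Finset V) : Ideal (StanleyReisnerRing k Δ) :=
  Ideal.span (srVar k Δ '' {i | i ∉ σ})

lemma faceIdeal_le_srMaxIdeal (σ : Finset V) : faceIdeal k Δ σ ≤ srMaxIdeal k Δ :=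
  Ideal.span_mono (Set.image_subset_range _ _)

lemma ker_faceMap {σ : Finset V} (h : IsFaceOrEmpty Δ σ) :
    RingHom.ker (faceMap k h) = faceIdeal k Δ σ := by
  classical
  apply le_antisymm
  · intro r hr
    obtain ⟨f, rfl⟩ := Ideal.Quotient.mk_surjective r
    rw [RingHom.mem_ker, faceMap_mk] at hr
    have hf : f ∈ Ideal.span (MvPolynomial.X '' {i | i ∉ σ} : Set (MvPolynomial V k)) := by
      rw [MvPolynomial.mem_ideal_span_X_image]
      intro m hm
      by_contra! hcon
      have hsub : m.support ⊆ σ := by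
        intro i hi
        by_contra hiσ
        exact Finsupp.mem_support_iff.1 hi (hcon i hiσ)
      have := congrArg (MvPolynomial.coeff m) hr
      rw [coeff_restrictVars, if_pos hsub, MvPolynomial.coeff_zero] at this
      exact MvPolynomial.mem_support_iff.1 hm this
    have := Ideal.mem_map_of_mem (Ideal.Quotient.mk (stanleyReisnerIdeal k Δ)) hf
    rw [Ideal.map_span, ← Set.image_comp] at this
    exact this
  · rw [faceIdeal, Ideal.span_le]
    rintro _ ⟨i, hi, rfl⟩
    rw [SetLike.mem_coe, RingHom.mem_ker, faceMap_srVar, if_neg hi]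

instance isPrime_ker_faceMap {σ : Finset V} (h : IsFaceOrEmpty Δ σ) :
    (RingHom.ker (faceMap k h)).IsPrime := RingHom.ker_isPrime _

open Classical in
variable (k Δ) in
lemma prod_faceIdeal_eq_bot [Fintype V] :
    ∏ σ ∈ Finset.univ.filter (fun σ => IsFaceOrEmpty Δ σ), faceIdeal k Δ σ = ⊥ := by
  rw [eq_bot_iff]
  intro r hr
  rw [Ideal.mem_bot]
  refine eq_zero_of_faceMap fun σ h => ?_
  rw [← RingHom.mem_ker, ker_faceMap]
  exact (Ideal.prod_le_inf.trans (Finset.inf_le (Finset.mem_filter.2 ⟨Finset.mem_univ σ, h⟩))) hr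

/-! ### Linear forms without common zeros -/

open Polynomial in
/-- Restriction of the elements of `k[Δ]` to the line through the point of `k ^ σ` with
coordinates `u i`, `i ∈ σ`. -/
def lineMap {σ : Finset V} (h : IsFaceOrEmpty Δ σ) (u : V → k) :
    StanleyReisnerRing k Δ →ₐ[k] k[X] :=
  (MvPolynomial.aeval fun i => C (u i) * X).comp (faceMap k h)

open Polynomial Classical in
lemma lineMap_srVar {σ : Finset V} (h : IsFaceOrEmpty Δ σ) (u : V → k) (i : V) :
    lineMap h u (srVar k Δ i) = if i ∈ σ then C (u i) * X else 0 := by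
  rw [lineMap, AlgHom.comp_apply, faceMap_srVar]
  split_ifs
  · rw [MvPolynomial.aeval_X]
  · rw [map_zero]

open Polynomial in
lemma map_lineMap_srMaxIdeal_pow_le {σ : Finset V} (h : IsFaceOrEmpty Δ σ) (u : V → k) (n : ℕ) :
    (srMaxIdeal k Δ ^ n).map (lineMap h u) ≤ Ideal.span {(X : k[X]) ^ n} := by
  rw [Ideal.map_pow, ← Ideal.span_singleton_pow]
  refine Ideal.pow_right_mono ?_ n
  rw [srMaxIdeal, Ideal.map_span, Ideal.span_le]
  rintro _ ⟨_, ⟨i, rfl⟩, rfl⟩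
  rw [lineMap_srVar, SetLike.mem_coe, Ideal.mem_span_singleton]
  split_ifs
  · exact dvd_mul_left _ _
  · exact dvd_zero _

open Polynomial in
/-- The linear parts of the elements of `L` have no common zero other than the origin on any of the
coordinate subspaces `k ^ σ`, `σ ∈ Δ`. For elements of the maximal homogeneous ideal this says that
the linear parts restrict to a spanning set of the linear forms on each `k ^ σ`. -/
def LinearPartsSpan (L : Set (StanleyReisnerRing k Δ)) : Prop :=
  ∀ (σ : Finset V) (h : IsFaceOrEmpty Δ σ) (u : V → k), (∃ i ∈ σ, u i ≠ 0) →
    ∃ l ∈ L, ¬ (X : k[X]) ^ 2 ∣ lineMap h u l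

variable (k Δ) in
/-- The space of linear forms of `k[Δ]`. -/
abbrev linearForms : Submodule k (StanleyReisnerRing k Δ) :=
  Submodule.span k (Set.range (srVar k Δ))

lemma linearForms_le_srMaxIdeal {l : StanleyReisnerRing k Δ} (hl : l ∈ linearForms k Δ) :
    l ∈ srMaxIdeal k Δ :=
  (Submodule.span_le_restrictScalars k (StanleyReisnerRing k Δ) (Set.range (srVar k Δ))) hl

lemma exists_sub_algebraMap_mem_srMaxIdeal (r : StanleyReisnerRing k Δ) :
    ∃ c : k, r - algebraMap k _ c ∈ srMaxIdeal k Δ := by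
  obtain ⟨f, rfl⟩ := Ideal.Quotient.mk_surjective r
  refine ⟨f.coeff 0, ?_⟩
  have : algebraMap k (StanleyReisnerRing k Δ) (f.coeff 0) =
    Ideal.Quotient.mk (stanleyReisnerIdeal k Δ) (MvPolynomial.C (f.coeff 0)) := rfl
  rw [this, ← map_sub, ← pow_one (srMaxIdeal k Δ), mk_mem_srMaxIdeal_pow_iff]
  intro m hm _
  rw [Nat.one_le_iff_ne_zero]
  intro h0
  rw [Finsupp.degree_eq_zero_iff] at h0
  subst h0
  simp at hm

lemma exists_linearForm_sub_mem {r : StanleyReisnerRing k Δ} (hr : r ∈ srMaxIdeal k Δ) :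
    ∃ l ∈ linearForms k Δ, r - l ∈ srMaxIdeal k Δ ^ 2 := by
  induction hr using Submodule.span_induction with
  | mem x hx => exact ⟨x, Submodule.subset_span hx, by simp⟩
  | zero => exact ⟨0, Submodule.zero_mem _, by simp⟩
  | add x y _ _ hx hy =>
    obtain ⟨l, hl, h1⟩ := hx
    obtain ⟨l', hl', h2⟩ := hy
    refine ⟨l + l', Submodule.add_mem _ hl hl', ?_⟩
    rw [add_sub_add_comm]
    exact Ideal.add_mem _ h1 h2
  | smul a x hx hx' =>
    obtain ⟨l, hl, h1⟩ := hx'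
    obtain ⟨c, hc⟩ := exists_sub_algebraMap_mem_srMaxIdeal a
    refine ⟨c • l, Submodule.smul_mem _ _ hl, ?_⟩
    have e : a • x - c • l = (a - algebraMap k _ c) * x + algebraMap k _ c * (x - l) := by
      rw [smul_eq_mul, ← Algebra.smul_def, smul_sub, sub_mul, Algebra.smul_def _ x]
      abel
    rw [e]
    refine Ideal.add_mem _ ?_ (Ideal.mul_mem_left _ _ h1)
    rw [pow_two]
    exact Ideal.mul_mem_mul hc hx

lemma exists_eq_sum_smul_srVar [Fintype V] {l : StanleyReisnerRing k Δ}
    (hl : l ∈ linearForms k Δ) : ∃ c : V → k, l = ∑ i, c i • srVar k Δ i := by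
  obtain ⟨c, hc⟩ := (Submodule.mem_span_range_iff_exists_fun k).1 hl
  exact ⟨c, hc.symm⟩

open Polynomial Classical in
lemma lineMap_sum_smul_srVar [Fintype V] {σ : Finset V} (h : IsFaceOrEmpty Δ σ) (u c : V → k) :
    lineMap h u (∑ i, c i • srVar k Δ i) = C (∑ i ∈ σ, c i * u i) * X := by
  rw [map_sum]
  simp only [map_smul, lineMap_srVar]
  rw [map_sum, Finset.sum_mul, ← Finset.sum_subset (Finset.subset_univ σ)]
  · refine Finset.sum_congr rfl fun i hi => ?_
    rw [if_pos hi, smul_eq_C_mul, C_mul, mul_assoc]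
  · intro i _ hi
    rw [if_neg hi, smul_zero]

/-- Linear forms without common zeros on `k ^ σ` generate the maximal homogeneous ideal modulo the
variables outside `σ`. -/
lemma LinearPartsSpan.srMaxIdeal_le_sup [Fintype V] {L : Set (StanleyReisnerRing k Δ)}
    (hL : LinearPartsSpan L) (hlin : L ⊆ linearForms k Δ) {σ : Finset V}
    (h : IsFaceOrEmpty Δ σ) : srMaxIdeal k Δ ≤ Ideal.span L ⊔ faceIdeal k Δ σ := by
  classical
  set Φ : (V → k) →ₗ[k] StanleyReisnerRing k Δ := Fintype.linearCombination k (srVar k Δ) with hΦ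
  have hΦa : ∀ c, Φ c = ∑ i, c i • srVar k Δ i := fun c => Fintype.linearCombination_apply k _ c
  have hΦs : ∀ i, Φ (Pi.single i 1) = srVar k Δ i := by
    intro i
    rw [hΦa, Finset.sum_eq_single i]
    · simp
    · intro j _ hj; simp [hj]
    · simp
  set W : Submodule k (V → k) :=
    ((Ideal.span L ⊔ faceIdeal k Δ σ).restrictScalars k).comap Φ with hW
  have hmemW : ∀ c, c ∈ W ↔ Φ c ∈ Ideal.span L ⊔ faceIdeal k Δ σ := fun c => Iff.rfl
  have hWtop : W = ⊤ := by
    by_contra hne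
    obtain ⟨f, hf0, hf⟩ := Submodule.exists_le_ker_of_lt_top W (lt_top_iff_ne_top.2 hne)
    have hfsum : ∀ c, f c = ∑ i, c i * f (Pi.single i 1) := by
      intro c
      conv_lhs => rw [pi_eq_sum_univ' c]
      rw [map_sum]
      exact Finset.sum_congr rfl fun i _ => by rw [map_smul, smul_eq_mul]
    have hout : ∀ i, i ∉ σ → f (Pi.single i 1) = 0 := by
      intro i hi
      refine hf ((hmemW _).2 ?_)
      rw [hΦs]
      exact Ideal.mem_sup_right (Ideal.subset_span ⟨i, hi, rfl⟩)
    obtain ⟨i, hi⟩ : ∃ i, f (Pi.single i 1) ≠ 0 := by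
      by_contra! hcon
      refine hf0 (LinearMap.ext fun c => ?_)
      rw [hfsum, LinearMap.zero_apply]
      exact Finset.sum_eq_zero fun i _ => by rw [hcon, mul_zero]
    have hiσ : i ∈ σ := by
      by_contra hiσ
      exact hi (hout i hiσ)
    obtain ⟨l, hlL, hl⟩ := hL σ h (fun i => f (Pi.single i 1)) ⟨i, hiσ, hi⟩
    obtain ⟨c, rfl⟩ := exists_eq_sum_smul_srVar (hlin hlL)
    have hc : f c = 0 := hf ((hmemW _).2 (by
      rw [hΦa]; exact Ideal.mem_sup_left (Ideal.subset_span hlL)))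
    rw [hfsum, ← Finset.sum_subset (Finset.subset_univ σ)
      (fun i _ hi => by rw [hout i hi, mul_zero])] at hc
    rw [lineMap_sum_smul_srVar, hc] at hl
    simp at hl
  rw [srMaxIdeal, Ideal.span_le]
  rintro _ ⟨i, rfl⟩
  rw [← hΦs]
  exact (hmemW _).1 (hWtop ▸ Submodule.mem_top)

/-- Linear forms without common zeros on the faces generate a reduction of the maximal homogeneous
ideal: they do so modulo the ideal of each face, and the product of these ideals vanishes. -/
lemma LinearPartsSpan.exists_pow_succ_le [Fintype V] {L : Set (StanleyReisnerRing k Δ)}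
    (hL : LinearPartsSpan L) (hlin : L ⊆ linearForms k Δ) :
    ∃ N, srMaxIdeal k Δ ^ (N + 1) ≤ Ideal.span L * srMaxIdeal k Δ ^ N := by
  classical
  refine ⟨_, (Ideal.pow_card_succ_le_of_forall_le_sup (srMaxIdeal k Δ) (Ideal.span L)
    (faceIdeal k Δ) (Finset.univ.filter fun σ => IsFaceOrEmpty Δ σ)
    (fun σ _ => faceIdeal_le_srMaxIdeal σ)
    fun σ hσ => hL.srMaxIdeal_le_sup hlin (Finset.mem_filter.1 hσ).2).trans ?_⟩
  rw [prod_faceIdeal_eq_bot, Ideal.mul_bot, sup_bot_eq]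

open Polynomial in
/-- The linear parts of the generators of a reduction of the maximal homogeneous ideal have no
common zeros on the faces, since the reduction equation can be restricted to lines. -/
lemma linearPartsSpan_of_pow_succ_le {L : Set (StanleyReisnerRing k Δ)} {N : ℕ}
    (hN : srMaxIdeal k Δ ^ (N + 1) ≤
      Ideal.span L * srMaxIdeal k Δ ^ N ⊔ srMaxIdeal k Δ ^ (N + 2)) : LinearPartsSpan L := by
  rintro σ h u ⟨i, hiσ, hui⟩
  by_contra! hcon
  have hL : (Ideal.span L).map (lineMap h u) ≤ Ideal.span {(X : k[X]) ^ 2} := by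
    rw [Ideal.map_span, Ideal.span_le]
    rintro _ ⟨l, hl, rfl⟩
    exact Ideal.mem_span_singleton.2 (hcon l hl)
  have h1 := Ideal.mem_map_of_mem (lineMap h u)
    (hN (Ideal.pow_mem_pow (srVar_mem_srMaxIdeal i) (N + 1)))
  rw [Ideal.map_sup, Ideal.map_mul] at h1
  have h2 : (Ideal.span L).map (lineMap h u) * (srMaxIdeal k Δ ^ N).map (lineMap h u) ⊔
      (srMaxIdeal k Δ ^ (N + 2)).map (lineMap h u) ≤ Ideal.span {(X : k[X]) ^ (N + 2)} := by
    refine sup_le ?_ (map_lineMap_srMaxIdeal_pow_le h u _)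
    refine (Ideal.mul_mono hL (map_lineMap_srMaxIdeal_pow_le h u N)).trans ?_
    rw [Ideal.span_singleton_mul_span_singleton, ← pow_add, add_comm]
  have h3 := h2 h1
  rw [map_pow, lineMap_srVar, if_pos hiσ, mul_pow, Ideal.mem_span_singleton,
    X_pow_dvd_iff] at h3
  have h4 := h3 (N + 1) (by omega)
  rw [← C_pow, coeff_C_mul, coeff_X_pow_self, mul_one] at h4
  exact pow_ne_zero _ hui h4

lemma LinearPartsSpan.congr {L L' : Set (StanleyReisnerRing k Δ)} (hL : LinearPartsSpan L)
    (h : ∀ l ∈ L, ∃ l' ∈ L', l - l' ∈ srMaxIdeal k Δ ^ 2) : LinearPartsSpan L' := by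
  intro σ hσ u hu
  obtain ⟨l, hl, hdvd⟩ := hL σ hσ u hu
  obtain ⟨l', hl', hsub⟩ := h l hl
  refine ⟨l', hl', fun hcon => hdvd ?_⟩
  have := map_lineMap_srMaxIdeal_pow_le hσ u 2 (Ideal.mem_map_of_mem (lineMap hσ u) hsub)
  rw [Ideal.mem_span_singleton, map_sub] at this
  exact (dvd_sub_left hcon).1 this

open Polynomial in
/-- Linear forms that generate an ideal of finite colength have no common zeros on the faces:
the coordinate ring of a line of common zeros would be a finite-dimensional quotient. -/
lemma IsLinearSOP.linearPartsSpan [Fintype V] {d : ℕ} {θ : Fin d → StanleyReisnerRing k Δ}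
    (hθ : IsLinearSOP k Δ θ) : LinearPartsSpan (Set.range θ) := by
  rintro σ h u ⟨i, hiσ, hui⟩
  by_contra! hcon
  have hzero : ∀ x ∈ Ideal.span (Set.range θ), lineMap h u x = 0 := by
    intro x hx
    have hle : Ideal.span (Set.range θ) ≤ RingHom.ker (lineMap h u) := by
      rw [Ideal.span_le]
      rintro _ ⟨j, rfl⟩
      obtain ⟨c, hc⟩ := exists_eq_sum_smul_srVar (hθ.2.1 j)
      have h1 := hcon (θ j) ⟨j, rfl⟩
      rw [SetLike.mem_coe, RingHom.mem_ker]
      rw [hc, lineMap_sum_smul_srVar] at h1 ⊢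
      rw [X_pow_dvd_iff] at h1
      have h2 := h1 1 (by norm_num)
      rw [coeff_C_mul, coeff_X_one, mul_one] at h2
      rw [h2, C_0, zero_mul]
    exact hle hx
  have := hθ.2.2
  set g := Ideal.Quotient.liftₐ (Ideal.span (Set.range θ)) (lineMap h u) hzero with hg
  have hsurj : Function.Surjective g := by
    intro q
    refine ⟨Ideal.Quotient.mk _ (Polynomial.aeval ((u i)⁻¹ • srVar k Δ i) q), ?_⟩
    change lineMap h u (Polynomial.aeval ((u i)⁻¹ • srVar k Δ i) q) = q
    rw [← Polynomial.aeval_algHom_apply, map_smul, lineMap_srVar, if_pos hiσ, smul_eq_C_mul,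
      ← mul_assoc, ← C_mul, inv_mul_cancel₀ hui, C_1, one_mul, Polynomial.aeval_X_left_apply]
  have hfin : Module.Finite k k[X] := Module.Finite.of_surjective g.toLinearMap hsurj
  exact Polynomial.not_finite hfin

end StanleyReisnerBasics

/-! ### Tight closures of products of linear parameter ideals -/

lemma Ideal.prod_pow_le_pow_sum {R ι : Type*} [CommRing R] [Fintype ι] (M : Ideal R)
    (I : ι → Ideal R) (s : ι → ℕ) (h : ∀ i, I i ≤ M) : ∏ i, I i ^ s i ≤ M ^ (∑ i, s i) := by
  rw [← Finset.prod_pow_eq_pow_sum]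
  exact Finset.prod_le_prod' fun i _ => Ideal.pow_right_mono (h i) _

lemma Ideal.pow_sum_le_prod_pow_sup {R ι : Type*} [CommRing R] [Fintype ι] (M P : Ideal R)
    (I : ι → Ideal R) (s : ι → ℕ) (h : ∀ i, M ≤ I i ⊔ P) :
    M ^ (∑ i, s i) ≤ (∏ i, I i ^ s i) ⊔ P := by
  have h1 : ∀ i, M.map (Ideal.Quotient.mk P) ≤ (I i).map (Ideal.Quotient.mk P) := by
    intro i
    have := Ideal.map_mono (f := Ideal.Quotient.mk P) (h i)
    rwa [Ideal.map_sup, Ideal.map_quotient_self, sup_bot_eq] at this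
  have h2 : (M ^ (∑ i, s i)).map (Ideal.Quotient.mk P) ≤
      (∏ i, I i ^ s i).map (Ideal.Quotient.mk P) := by
    have hprod : (∏ i, I i ^ s i).map (Ideal.Quotient.mk P) =
        ∏ i, (I i ^ s i).map (Ideal.Quotient.mk P) :=
      map_prod (Ideal.mapHom (Ideal.Quotient.mk P)) _ _
    rw [Ideal.map_pow, hprod, ← Finset.prod_pow_eq_pow_sum]
    refine Finset.prod_le_prod' fun i _ => ?_
    rw [Ideal.map_pow]
    exact Ideal.pow_right_mono (h1 i) _
  have h3 := Ideal.map_le_iff_le_comap.1 h2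
  rwa [Ideal.comap_map_of_surjective' _ Ideal.Quotient.mk_surjective, Ideal.mk_ker] at h3

lemma mem_tightClosure {R : Type*} [CommRing R] {p : ℕ} [Fact p.Prime] [CharP R p] {I : Ideal R}
    {x : R} : x ∈ tightClosure p I ↔
      ∃ c ∈ ringCirc R, ∀ᶠ e : ℕ in atTop, c * x ^ p ^ e ∈ frobeniusPower p I e :=
  Iff.rfl

section TightClosureStanleyReisner

variable {k : Type*} [Field k] {V : Type*} {Δ : AbstractSimplicialComplex V}

lemma exists_faceIdeal_le_of_isPrime [Fintype V] (P : Ideal (StanleyReisnerRing k Δ))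
    [hP : P.IsPrime] :
    ∃ F, Maximal (IsFaceOrEmpty Δ) F ∧ faceIdeal k Δ F ≤ P := by
  classical
  have h0 : ∏ σ ∈ Finset.univ.filter (fun σ => IsFaceOrEmpty Δ σ), faceIdeal k Δ σ ≤ P := by
    rw [prod_faceIdeal_eq_bot]; exact bot_le
  obtain ⟨σ, hσ, hle⟩ := hP.prod_le.1 h0
  obtain ⟨F, hF, hmax⟩ := (Set.toFinite {τ | IsFaceOrEmpty Δ τ}).exists_le_maximal
    (Finset.mem_filter.1 hσ).2
  refine ⟨F, hmax, (Ideal.span_mono (Set.image_mono ?_)).trans hle⟩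
  exact fun i hi hiσ => hi (hF hiσ)

lemma exists_eq_faceIdeal_of_mem_minimalPrimes [Fintype V] {P : Ideal (StanleyReisnerRing k Δ)}
    (hP : P ∈ minimalPrimes (StanleyReisnerRing k Δ)) :
    ∃ F, Maximal (IsFaceOrEmpty Δ) F ∧ P = faceIdeal k Δ F := by
  have := hP.1.1
  obtain ⟨F, hF, hle⟩ := exists_faceIdeal_le_of_isPrime P
  have hprime : (faceIdeal k Δ F).IsPrime := ker_faceMap (k := k) hF.1 ▸ isPrime_ker_faceMap hF.1
  exact ⟨F, hF, le_antisymm (hP.2 ⟨hprime, bot_le⟩ hle) hle⟩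

lemma faceIdeal_mem_minimalPrimes [Fintype V] {F : Finset V} (hF : Maximal (IsFaceOrEmpty Δ) F) :
    faceIdeal k Δ F ∈ minimalPrimes (StanleyReisnerRing k Δ) := by
  classical
  have hprime : (faceIdeal k Δ F).IsPrime := ker_faceMap (k := k) hF.1 ▸ isPrime_ker_faceMap hF.1
  refine ⟨⟨hprime, bot_le⟩, ?_⟩
  rintro Q ⟨hQ, -⟩ hQF
  have : Q.IsPrime := hQ
  obtain ⟨G, hG, hGQ⟩ := exists_faceIdeal_le_of_isPrime Q
  have hFG : F ⊆ G := by
    intro i hi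
    by_contra hiG
    have h1 : srVar k Δ i ∈ faceIdeal k Δ F := hQF (hGQ (Ideal.subset_span ⟨i, hiG, rfl⟩))
    rw [← ker_faceMap hF.1, RingHom.mem_ker, faceMap_srVar, if_pos hi] at h1
    exact MvPolynomial.X_ne_zero i h1
  have : F = G := le_antisymm hFG (hF.2 hG.1 hFG)
  rwa [this]

lemma prod_srVar_mul_eq_zero {F : Finset V} (hF : Maximal (IsFaceOrEmpty Δ) F)
    {z : StanleyReisnerRing k Δ} (hz : z ∈ faceIdeal k Δ F) : (∏ i ∈ F, srVar k Δ i) * z = 0 := by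
  classical
  induction hz using Submodule.span_induction with
  | mem x hx =>
    obtain ⟨i, hi, rfl⟩ := hx
    have hnot : insert i F ∉ Δ.faces := fun h =>
      hi (hF.2 (Or.inr h) (Finset.subset_insert i F) (Finset.mem_insert_self i F))
    have hgen : (∏ j ∈ insert i F, MvPolynomial.X j : MvPolynomial V k) ∈
        stanleyReisnerIdeal k Δ :=
      Ideal.subset_span ⟨_, Finset.insert_nonempty i F, hnot, rfl⟩
    rw [Finset.prod_insert hi, mul_comm] at hgen
    have := Ideal.Quotient.eq_zero_iff_mem.2 hgen
    rw [map_mul, map_prod] at this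
    exact this
  | zero => exact mul_zero _
  | add x y _ _ hx hy => rw [mul_add, hx, hy, add_zero]
  | smul a x _ hx => rw [smul_eq_mul, mul_left_comm, hx, mul_zero]

variable (k Δ) in
open Classical in
/-- The sum of the squarefree monomials of the facets: an element outside all minimal primes each
of whose summands kills the minimal prime of its facet. -/
def facetSum [Fintype V] : StanleyReisnerRing k Δ :=
  ∑ F ∈ Finset.univ.filter (fun F => Maximal (IsFaceOrEmpty Δ) F), ∏ i ∈ F, srVar k Δ i

variable (k Δ) in
lemma facetSum_mem_ringCirc [Fintype V] : facetSum k Δ ∈ ringCirc (StanleyReisnerRing k Δ) := by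
  classical
  intro P hP hmem
  obtain ⟨G, hG, rfl⟩ := exists_eq_faceIdeal_of_mem_minimalPrimes hP
  rw [← ker_faceMap hG.1, RingHom.mem_ker, facetSum, map_sum,
    Finset.sum_eq_single G] at hmem
  · rw [map_prod, Finset.prod_congr rfl fun i hi => by rw [faceMap_srVar, if_pos hi],
      Finset.prod_eq_zero_iff] at hmem
    obtain ⟨i, _, hi⟩ := hmem
    exact MvPolynomial.X_ne_zero i hi
  · intro F hF hne
    rw [Finset.mem_filter] at hF
    have hnot : ¬ F ⊆ G := fun h => hne (le_antisymm h (hF.2.2 hG.1 h))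
    obtain ⟨i, hi, hiG⟩ := Finset.not_subset.1 hnot
    rw [map_prod]
    exact Finset.prod_eq_zero hi (by rw [faceMap_srVar, if_neg hiG])
  · intro h
    exact absurd (Finset.mem_filter.2 ⟨Finset.mem_univ _, hG⟩) h

lemma map_faceMap_srMaxIdeal_pow_le {σ : Finset V} (h : IsFaceOrEmpty Δ σ) (n : ℕ) :
    (srMaxIdeal k Δ ^ n).map (faceMap k h) ≤ MvPolynomial.idealOfVars V k ^ n := by
  classical
  rw [Ideal.map_pow]
  refine Ideal.pow_right_mono ?_ n
  rw [srMaxIdeal, Ideal.map_span, Ideal.span_le]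
  rintro _ ⟨_, ⟨i, rfl⟩, rfl⟩
  rw [faceMap_srVar, SetLike.mem_coe]
  split_ifs
  · exact Ideal.subset_span ⟨i, rfl⟩
  · exact Ideal.zero_mem _

lemma le_order_of_mem_pow_idealOfVars {n : ℕ} {f : MvPolynomial V k}
    (hf : f ∈ MvPolynomial.idealOfVars V k ^ n) : (n : ℕ∞) ≤ (f : MvPowerSeries V k).order := by
  rw [MvPolynomial.mem_pow_idealOfVars_iff'] at hf
  refine MvPowerSeries.nat_le_order fun m hm => ?_
  rw [MvPolynomial.coeff_coe]
  exact hf m hm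

/-- If an ideal lies in the `n`-th power of the maximal homogeneous ideal, so does its tight
closure: compare orders on each facet. -/
lemma tightClosure_le_srMaxIdeal_pow [Fintype V] (p : ℕ) [Fact p.Prime] [CharP k p]
    {K : Ideal (StanleyReisnerRing k Δ)} {n : ℕ} (hK : K ≤ srMaxIdeal k Δ ^ n) :
    tightClosure p K ≤ srMaxIdeal k Δ ^ n := by
  classical
  intro x hx
  obtain ⟨c, hc, hx⟩ := mem_tightClosure.1 hx
  -- it suffices to bound the order of the restriction to each facet
  have key : ∀ (F : Finset V) (hF : Maximal (IsFaceOrEmpty Δ) F) (m : V →₀ ℕ), m.degree < n →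
      (faceMap k hF.1 x).coeff m = 0 := by
    intro F hF m hm
    have hc0 : faceMap k hF.1 c ≠ 0 := fun h0 =>
      hc _ (faceIdeal_mem_minimalPrimes hF) (by rwa [← ker_faceMap hF.1])
    set C : MvPowerSeries V k := MvPolynomial.toMvPowerSeries (faceMap k hF.1 c) with hC
    set g : MvPowerSeries V k := MvPolynomial.toMvPowerSeries (faceMap k hF.1 x) with hg
    have hC0 : C ≠ 0 := fun h => hc0 (MvPolynomial.coe_eq_zero_iff.1 h)
    have hord : ∀ᶠ e : ℕ in atTop, ((n * p ^ e : ℕ) : ℕ∞) ≤ C.order + (p ^ e : ℕ) * g.order := by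
      filter_upwards [hx] with e he
      have hfrob : (frobeniusPower p K e).map (faceMap k hF.1) ≤
          MvPolynomial.idealOfVars V k ^ (n * p ^ e) := by
        rw [Ideal.map_le_iff_le_comap, frobeniusPower, Ideal.map_le_iff_le_comap]
        intro y hy
        rw [Ideal.mem_comap, Ideal.mem_comap, iterateFrobenius_def, map_pow, pow_mul]
        exact Ideal.pow_mem_pow (map_faceMap_srMaxIdeal_pow_le hF.1 n
          (Ideal.mem_map_of_mem _ (hK hy))) _
      have h1 := le_order_of_mem_pow_idealOfVars (hfrob (Ideal.mem_map_of_mem (faceMap k hF.1) he))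
      rw [map_mul, map_pow, MvPolynomial.coe_mul, MvPolynomial.coe_pow,
        MvPowerSeries.order_mul] at h1
      have h2 : ∀ j : ℕ, (g ^ j).order = (j : ℕ) * g.order := by
        intro j
        simpa using MvPowerSeries.order_prod (fun _ => g) (Finset.range j)
      rwa [h2] at h1
    have hgn : (n : ℕ∞) ≤ g.order := by
      by_contra! hlt
      obtain ⟨b, hb⟩ := ENat.ne_top_iff_exists.1
        (mt MvPowerSeries.order_eq_top_iff.1 hC0)
      obtain ⟨a, ha⟩ := ENat.ne_top_iff_exists.1 hlt.ne_top
      rw [← ha] at hlt hord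
      rw [← hb] at hord
      obtain ⟨N, hN⟩ := eventually_atTop.1 hord
      have hlt' : a < n := by exact_mod_cast hlt
      have h3 := hN (max N b) (le_max_left _ _)
      have h4 : n * p ^ max N b ≤ b + p ^ max N b * a := by exact_mod_cast h3
      have h5 : max N b < p ^ max N b := Nat.lt_pow_self (Fact.out : p.Prime).one_lt
      have h6 : b ≤ max N b := le_max_right _ _
      nlinarith
    have := MvPowerSeries.coeff_of_lt_order (f := g) (d := m)
      (lt_of_lt_of_le (by exact_mod_cast hm) hgn)
    rwa [hg, MvPolynomial.coeff_coe] at this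
  refine mem_srMaxIdeal_pow_of_faceMap fun σ h m hm => ?_
  obtain ⟨F, hσF, hF⟩ := (Set.toFinite {τ | IsFaceOrEmpty Δ τ}).exists_le_maximal h
  have h0 := key F hF m hm
  obtain ⟨f, rfl⟩ := Ideal.Quotient.mk_surjective x
  rw [faceMap_mk, coeff_restrictVars] at h0 ⊢
  split_ifs with hmσ
  · rwa [if_pos (hmσ.trans hσF)] at h0
  · rfl

/-- An element that lies in `K + P` for the minimal prime `P` of every facet lies in the tight
closure of `K`. -/
lemma le_tightClosure_of_le_sup_faceIdeal [Fintype V] (p : ℕ) [Fact p.Prime] [CharP k p]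
    {K M : Ideal (StanleyReisnerRing k Δ)}
    (hM : ∀ F, Maximal (IsFaceOrEmpty Δ) F → M ≤ K ⊔ faceIdeal k Δ F) : M ≤ tightClosure p K := by
  classical
  intro x hx
  refine mem_tightClosure.2 ⟨facetSum k Δ, facetSum_mem_ringCirc k Δ,
    Eventually.of_forall fun e => ?_⟩
  rw [facetSum, Finset.sum_mul]
  refine Ideal.sum_mem _ fun F hF => ?_
  have hF' := (Finset.mem_filter.1 hF).2
  obtain ⟨y, hy, z, hz, rfl⟩ := Submodule.mem_sup.1 (hM F hF' hx)
  have hq : p ^ e ≠ 0 := pow_ne_zero _ (Fact.out : p.Prime).ne_zero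
  rw [add_pow_char_pow, mul_add, prod_srVar_mul_eq_zero hF'
    (Ideal.pow_mem_of_mem _ hz _ (Nat.pos_of_ne_zero hq)), add_zero]
  refine Ideal.mul_mem_left _ _ ?_
  rw [← iterateFrobenius_def]
  exact Ideal.mem_map_of_mem _ hy

/-- The tight closure of a product of powers of linear parameter ideals is a power of the maximal
homogeneous ideal. -/
lemma tightClosure_prod_pow_eq [Fintype V] (p : ℕ) [Fact p.Prime] [CharP k p] {ι : Type*}
    [Fintype ι] {I : ι → Ideal (StanleyReisnerRing k Δ)} (hle : ∀ i, I i ≤ srMaxIdeal k Δ)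
    (hsup : ∀ i F, IsFaceOrEmpty Δ F → srMaxIdeal k Δ ≤ I i ⊔ faceIdeal k Δ F) (s : ι → ℕ) :
    tightClosure p (∏ i, I i ^ s i) = srMaxIdeal k Δ ^ (∑ i, s i) := by
  apply le_antisymm
  · refine tightClosure_le_srMaxIdeal_pow p ?_
    exact Ideal.prod_pow_le_pow_sum _ I s hle
  · exact le_tightClosure_of_le_sup_faceIdeal p fun F hF =>
      Ideal.pow_sum_le_prod_pow_sup _ _ I s fun i => hsup i F hF.1

end TightClosureStanleyReisner

/-! ### Lengths over algebras with a rational point -/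

lemma Module.length_eq_length_of_smul_eq_bot {k R X : Type*} [Field k] [CommRing R] [Algebra k R]
    [AddCommGroup X] [Module k X] [Module R X] [IsScalarTower k R X] (M : Ideal R)
    (hM : ∀ r : R, ∃ c : k, r - algebraMap k R c ∈ M)
    (hX : M • (⊤ : Submodule R X) = ⊥) : Module.length R X = Module.length k X := by
  have hsurj : Function.Surjective (Submodule.restrictScalarsEmbedding k R X) := by
    intro Y
    refine ⟨{ Y with smul_mem' := ?_ }, rfl⟩
    intro r x hx
    obtain ⟨c, hc⟩ := hM r
    have h0 : (r - algebraMap k R c) • x = 0 := by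
      have := Submodule.smul_mem_smul hc (Submodule.mem_top : x ∈ (⊤ : Submodule R X))
      rwa [hX, Submodule.mem_bot] at this
    rw [sub_smul, sub_eq_zero, algebraMap_smul] at h0
    rw [h0]
    exact Y.smul_mem c hx
  apply WithBot.coe_injective
  rw [Module.coe_length, Module.coe_length,
    Order.krullDim_eq_of_orderIso (RelIso.ofSurjective _ hsurj)]

/-- If `R = k + M` then the length of an `R`-module killed by a power of `M` is its dimension
over `k`. -/
lemma Module.length_eq_length_of_pow_smul_eq_bot {k R : Type*} [Field k] [CommRing R] [Algebra k R]
    (M : Ideal R) (hM : ∀ r : R, ∃ c : k, r - algebraMap k R c ∈ M) (N : ℕ) :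
    ∀ (X : Type*) [AddCommGroup X] [Module k X] [Module R X] [IsScalarTower k R X],
      M ^ N • (⊤ : Submodule R X) = ⊥ → Module.length R X = Module.length k X := by
  induction N with
  | zero =>
    intro X _ _ _ _ hX
    rw [pow_zero, Ideal.one_eq_top, Submodule.top_smul] at hX
    have : Subsingleton X := (Submodule.subsingleton_iff R).1 (subsingleton_of_bot_eq_top hX.symm)
    rw [Module.length_eq_zero, Module.length_eq_zero]
  | succ N ih =>
    intro X _ _ _ _ hX
    set Y : Submodule R X := M • (⊤ : Submodule R X) with hY
    have h1 : Module.length R Y = Module.length k Y := by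
      refine ih Y ?_
      apply Submodule.map_injective_of_injective Y.injective_subtype
      rw [Submodule.map_smul'', Submodule.map_top, Submodule.range_subtype, Submodule.map_bot, hY,
        ← Submodule.mul_smul, ← pow_succ, hX]
    have h2 : Module.length R (X ⧸ Y) = Module.length k (X ⧸ Y) := by
      refine Module.length_eq_length_of_smul_eq_bot M hM ?_
      rw [← Submodule.range_mkQ Y, ← Submodule.map_top, ← Submodule.map_smul'', ← hY,
        Submodule.mkQ_map_self]
    have e1 := Module.length_eq_add_of_exact Y.subtype Y.mkQ Y.injective_subtype
      Y.mkQ_surjective (LinearMap.exact_subtype_mkQ Y)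
    have e2 := Module.length_eq_add_of_exact (Y.subtype.restrictScalars k)
      (Y.mkQ.restrictScalars k) Y.injective_subtype Y.mkQ_surjective
      (LinearMap.exact_subtype_mkQ Y)
    rw [e1, h1, h2]
    exact e2.symm

/-! ### The Hilbert function of a Stanley–Reisner ring -/

section HilbertFunction

variable {k : Type*} [Field k] {V : Type*} [Fintype V] {Δ : AbstractSimplicialComplex V}

variable (Δ) in
open Classical in
/-- The faces of `Δ`, including the empty face. -/
def facesWithEmpty : Finset (Finset V) := Finset.univ.filter fun σ => IsFaceOrEmpty Δ σ

lemma mem_facesWithEmpty {σ : Finset V} : σ ∈ facesWithEmpty Δ ↔ IsFaceOrEmpty Δ σ := by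
  simp [facesWithEmpty]

variable (Δ) in
lemma sum_neg_one_pow_card_eq :
    ∑ σ ∈ facesWithEmpty Δ, (-1 : ℤ) ^ σ.card = 1 - simplicialEulerChar Δ := by
  classical
  have hne : ∀ σ ∈ Δ.faces, σ.Nonempty := fun σ hσ => (Δ.isRelLowerSet_faces hσ).1
  have hset : facesWithEmpty Δ =
      insert ∅ (Finset.univ.filter fun σ : Finset V => σ ∈ Δ.faces) := by
    ext σ
    rw [mem_facesWithEmpty, Finset.mem_insert, Finset.mem_filter]
    simp [IsFaceOrEmpty]
  rw [hset, Finset.sum_insert (fun h => by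
    simpa using hne ∅ (Finset.mem_filter.1 h).2), Finset.card_empty, pow_zero, sub_eq_add_neg,
    simplicialEulerChar, ← Finset.sum_neg_distrib]
  congr 1
  refine Finset.sum_congr ?_ fun σ hσ => ?_
  · ext σ
    simp
  · have h1 : 1 ≤ σ.card := Finset.card_pos.2 (hne σ (Finset.mem_filter.1 hσ).2)
    obtain ⟨m, hm⟩ := Nat.exists_eq_add_of_le h1
    rw [hm, Nat.add_sub_cancel_left, pow_add, pow_one, neg_one_mul]

variable (Δ) in
open Classical in
/-- The exponents of degree less than `N` of monomials that do not vanish in `k[Δ]`. -/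
def faceExponents (N : ℕ) : Finset (V →₀ ℕ) :=
  (facesWithEmpty Δ).biUnion fun σ => (Finset.range N).biUnion fun n => exponentsOn σ n

lemma mem_faceExponents {N : ℕ} {m : V →₀ ℕ} :
    m ∈ faceExponents Δ N ↔ IsFaceOrEmpty Δ m.support ∧ m.degree < N := by
  classical
  simp only [faceExponents, Finset.mem_biUnion, mem_facesWithEmpty, Finset.mem_range,
    mem_exponentsOn]
  constructor
  · rintro ⟨σ, hσ, n, hn, rfl, rfl⟩
    exact ⟨hσ, hn⟩
  · rintro ⟨h1, h2⟩
    exact ⟨_, h1, _, h2, rfl, rfl⟩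

lemma card_faceExponents (N : ℕ) :
    (faceExponents Δ (N + 1)).card = ∑ σ ∈ facesWithEmpty Δ, N.choose σ.card := by
  classical
  rw [faceExponents, Finset.card_biUnion]
  · refine Finset.sum_congr rfl fun σ _ => ?_
    rw [Finset.card_biUnion, sum_card_exponentsOn]
    intro n _ n' _ hne
    rw [Function.onFun, Finset.disjoint_left]
    intro m hm hm'
    exact hne ((mem_exponentsOn.1 hm).2.symm.trans (mem_exponentsOn.1 hm').2)
  · intro σ _ τ _ hne
    rw [Function.onFun, Finset.disjoint_left]
    intro m hm hm'
    simp only [Finset.mem_biUnion, mem_exponentsOn] at hm hm'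
    obtain ⟨_, _, h1, _⟩ := hm
    obtain ⟨_, _, h2, _⟩ := hm'
    exact hne (h1.symm.trans h2)

variable (k Δ) in
/-- The monomials of degree less than `N` supported on faces form a basis of `k[Δ] / 𝔪 ^ N`. -/
def quotSrMaxIdealPowEquiv (N : ℕ) :
    (StanleyReisnerRing k Δ ⧸ srMaxIdeal k Δ ^ N) ≃ₗ[k] (faceExponents Δ N → k) :=
  let q : MvPolynomial V k →ₗ[k] (StanleyReisnerRing k Δ ⧸ srMaxIdeal k Δ ^ N) :=
    ((Ideal.Quotient.mkₐ k (srMaxIdeal k Δ ^ N)).comp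
      (Ideal.Quotient.mkₐ k (stanleyReisnerIdeal k Δ))).toLinearMap
  let g : MvPolynomial V k →ₗ[k] (faceExponents Δ N → k) :=
    LinearMap.pi fun m => MvPolynomial.lcoeff k (m : V →₀ ℕ)
  have hq : Function.Surjective q :=
    Ideal.Quotient.mk_surjective.comp Ideal.Quotient.mk_surjective
  have hg : Function.Surjective g := fun c => by
    classical
    refine ⟨∑ m : faceExponents Δ N, MvPolynomial.monomial (m : V →₀ ℕ) (c m), ?_⟩
    funext m
    change MvPolynomial.coeff (m : V →₀ ℕ) _ = _
    rw [MvPolynomial.coeff_sum, Finset.sum_eq_single m]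
    · simp
    · intro m' _ hne
      rw [MvPolynomial.coeff_monomial, if_neg fun h => hne (Subtype.ext h)]
    · simp
  have hker : LinearMap.ker q = LinearMap.ker g := by
    ext f
    rw [LinearMap.mem_ker, LinearMap.mem_ker]
    change Ideal.Quotient.mk _ (Ideal.Quotient.mk _ f) = 0 ↔ _
    rw [Ideal.Quotient.eq_zero_iff_mem, mk_mem_srMaxIdeal_pow_iff]
    constructor
    · intro h
      funext m
      by_contra h0
      have h2 := mem_faceExponents.1 m.2
      have := h m (MvPolynomial.mem_support_iff.2 h0) h2.1
      omega
    · intro h m hm hface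
      by_contra! hlt
      exact MvPolynomial.mem_support_iff.1 hm
        (congrFun h ⟨m, mem_faceExponents.2 ⟨hface, hlt⟩⟩)
  (q.quotKerEquivOfSurjective hq).symm.trans ((Submodule.quotEquivOfEq _ _ hker).trans
    (g.quotKerEquivOfSurjective hg))

lemma length_quot_srMaxIdeal_pow (N : ℕ) :
    Module.length (StanleyReisnerRing k Δ) (StanleyReisnerRing k Δ ⧸ srMaxIdeal k Δ ^ N) =
      (faceExponents Δ N).card := by
  rw [Module.length_eq_length_of_pow_smul_eq_bot (k := k) (srMaxIdeal k Δ)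
    exists_sub_algebraMap_mem_srMaxIdeal N]
  · rw [(quotSrMaxIdealPowEquiv k Δ N).length_eq, Module.length_eq_finrank,
      Module.finrank_fintype_fun_eq_card, Fintype.card_coe]
  · rw [← Submodule.range_mkQ, ← Submodule.map_top, ← Submodule.map_smul'', smul_eq_mul,
      Ideal.mul_top, Submodule.mkQ_map_self]

end HilbertFunction

/-! ### Tight Hilbert coefficients -/

open Polynomial in
/-- If the lengths of `R / (K ^ n)^*` are given by a polynomial for large `n`, then the tight
Hilbert coefficients of `K` exist, and the last one is the value of this polynomial at `0` up to
sign. -/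
lemma tightHilbertCoeffs_of_polynomial {R : Type*} [CommRing R] (p : ℕ) [Fact p.Prime] [CharP R p]
    (d : ℕ) (K : Ideal R) (Q : ℚ[X]) (hdeg : Q.natDegree ≤ d)
    (hint : ∀ z : ℤ, ∃ w : ℤ, Q.eval (z : ℚ) = w) (len : ℕ → ℕ)
    (hlen : ∀ᶠ n : ℕ in atTop, Module.length R (R ⧸ tightClosure p (K ^ n)) = len n)
    (hQ : ∀ᶠ n : ℕ in atTop, (len n : ℚ) = Q.eval (n : ℚ)) :
    (∃ e, IsTightHilbertCoeffs p d K e) ∧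
      (lastTightHilbertCoeff p d K : ℚ) = (-1) ^ d * Q.eval 0 := by
  have hex : ∃ e, IsTightHilbertCoeffs p d K e := by
    obtain ⟨c, hc⟩ := Q.exists_int_coeff_choose d hdeg hint
    refine ⟨fun i => (-1) ^ (i : ℕ) * c (d - i), ?_⟩
    filter_upwards [hlen, hQ] with n h1 h2
    rw [h1]
    refine ⟨ENat.natCast_ne_top _, ?_⟩
    rw [ENat.toNat_natCast]
    have h3 : ((len n : ℤ) : ℚ) = ((∑ i : Fin (d + 1), (-1) ^ (i : ℕ) * ((-1) ^ (i : ℕ) *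
        c (d - i)) * (Nat.choose (n + d - 1 - (i : ℕ)) (d - (i : ℕ)) : ℤ) : ℤ) : ℚ) := by
      rw [Int.cast_natCast, h2, hc, Fin.sum_univ_eq_sum_range (fun i => (-1) ^ i * ((-1) ^ i *
        c (d - i)) * (Nat.choose (n + d - 1 - i) (d - i) : ℤ)), ← Finset.sum_range_reflect,
        Int.cast_sum]
      refine Finset.sum_congr rfl fun i hi => ?_
      have hi' : i ≤ d := Nat.lt_succ_iff.1 (Finset.mem_range.1 hi)
      have e1 : d + 1 - 1 - i = d - i := by omega
      have e2 : n + (d - i) - 1 = n + d - 1 - i := by omega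
      rw [e1, e2, ← mul_assoc, ← mul_pow]
      push_cast
      simp
    exact_mod_cast h3
  refine ⟨hex, ?_⟩
  rw [lastTightHilbertCoeff, dif_pos hex]
  have hspec := hex.choose_spec
  set e := hex.choose with he
  set c : ℕ → ℤ := fun j => (-1) ^ (d - j) * e (Fin.ofNat (d + 1) (d - j)) with hc
  have hev : ∀ᶠ n : ℕ in atTop, Q.eval (n : ℚ) =
      ∑ j ∈ Finset.range (d + 1), (c j : ℚ) * ((n + j - 1).choose j : ℚ) := by
    filter_upwards [hlen, hQ, hspec] with n h1 h2 h3
    rw [h1, ENat.toNat_natCast] at h3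
    have h4 : ((len n : ℤ) : ℚ) = _ := congrArg (Int.cast : ℤ → ℚ) h3.2
    rw [Int.cast_natCast, h2] at h4
    rw [h4]
    have h5 : ∀ i : Fin (d + 1), (-1) ^ (i : ℕ) * e i *
        (Nat.choose (n + d - 1 - (i : ℕ)) (d - (i : ℕ)) : ℤ) =
        (fun i : ℕ => (-1) ^ i * e (Fin.ofNat (d + 1) i) *
          (Nat.choose (n + d - 1 - i) (d - i) : ℤ)) i := by
      intro i
      simp
    rw [Finset.sum_congr rfl fun i _ => h5 i, Fin.sum_univ_eq_sum_range (fun i : ℕ => (-1) ^ i *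
      e (Fin.ofNat (d + 1) i) * (Nat.choose (n + d - 1 - i) (d - i) : ℤ)),
      ← Finset.sum_range_reflect, Int.cast_sum]
    refine Finset.sum_congr rfl fun j hj => ?_
    have hj' : j ≤ d := Nat.lt_succ_iff.1 (Finset.mem_range.1 hj)
    have e1 : d + 1 - 1 - j = d - j := by omega
    have e2 : d - (d - j) = j := by omega
    have e3 : n + d - 1 - (d - j) = n + j - 1 := by omega
    rw [e1, e2, e3]
    simp [hc]
  have h0 := Q.eval_zero_eq_of_eventually_eq d c hev
  rw [h0, hc]
  simp only [Nat.sub_zero]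
  push_cast
  rw [← mul_assoc, ← mul_pow]
  simp

lemma Finset.prod_pow_eq_prod_pow_ite {ι M : Type*} [CommMonoid M] [Fintype ι] [DecidableEq ι]
    (T : Finset ι) (f : ι → M) (n : ℕ) :
    (∏ j ∈ T, f j) ^ n = ∏ j, f j ^ (if j ∈ T then n else 0) := by
  rw [← Finset.prod_pow, ← Finset.prod_subset (Finset.subset_univ T)]
  · exact Finset.prod_congr rfl fun j hj => by rw [if_pos hj]
  · intro j _ hj
    rw [if_neg hj, pow_zero]

section TightHilbert

variable {k : Type*} [Field k] {V : Type*} [Fintype V] {Δ : AbstractSimplicialComplex V}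

/-- Up to sign the last tight Hilbert coefficient of a product of linear parameter ideals is
`1 - χ(Δ)`, whatever the number of factors. -/
lemma tightHilbertCoeffs_prod (p : ℕ) [Fact p.Prime] [CharP k p] {d : ℕ}
    (hcard : ∀ σ, IsFaceOrEmpty Δ σ → σ.card ≤ d) {ι : Type*} [Fintype ι]
    {I : ι → Ideal (StanleyReisnerRing k Δ)} (hle : ∀ i, I i ≤ srMaxIdeal k Δ)
    (hsup : ∀ i F, IsFaceOrEmpty Δ F → srMaxIdeal k Δ ≤ I i ⊔ faceIdeal k Δ F)
    (T : Finset ι) (hT : T.Nonempty) :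
    (∃ e, IsTightHilbertCoeffs p d (∏ j ∈ T, I j) e) ∧
      lastTightHilbertCoeff p d (∏ j ∈ T, I j) = (-1) ^ d * (1 - simplicialEulerChar Δ) := by
  classical
  have hT1 : 1 ≤ T.card := hT.card_pos
  set Q : Polynomial ℚ := ∑ σ ∈ facesWithEmpty Δ, Polynomial.chooseMulSubOne T.card σ.card with hQ
  have htc : ∀ n, tightClosure p ((∏ j ∈ T, I j) ^ n) = srMaxIdeal k Δ ^ (T.card * n) := by
    intro n
    have h1 := Finset.prod_pow_eq_prod_pow_ite T I n
    rw [h1, tightClosure_prod_pow_eq p hle hsup]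
    simp
  have hmain := tightHilbertCoeffs_of_polynomial p d (∏ j ∈ T, I j) Q
    (Polynomial.natDegree_sum_le_of_forall_le _ _ fun σ hσ =>
      (Polynomial.natDegree_chooseMulSubOne_le _ _).trans (hcard σ (mem_facesWithEmpty.1 hσ)))
    (fun z => ⟨∑ σ ∈ facesWithEmpty Δ, Ring.choose ((T.card : ℤ) * z - 1) σ.card, by
      rw [hQ, Polynomial.eval_finsetSum, Int.cast_sum]
      exact Finset.sum_congr rfl fun σ _ => Polynomial.eval_chooseMulSubOne_int _ _ _⟩)
    (fun n => (faceExponents Δ (T.card * n)).card)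
    (Eventually.of_forall fun n => by rw [htc, length_quot_srMaxIdeal_pow])
    (by
      filter_upwards [eventually_ge_atTop 1] with n hn
      have h1 : 1 ≤ T.card * n := Nat.mul_pos hT1 hn
      rw [← Nat.sub_add_cancel h1, card_faceExponents, hQ, Polynomial.eval_finsetSum, Nat.cast_sum]
      exact Finset.sum_congr rfl fun σ _ => (Polynomial.eval_chooseMulSubOne _ _ _ hT1 hn).symm)
  refine ⟨hmain.1, ?_⟩
  have h2 := hmain.2
  rw [hQ, Polynomial.eval_finsetSum,
    Finset.sum_congr rfl fun σ _ => Polynomial.eval_zero_chooseMulSubOne _ _] at h2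
  rw [← sum_neg_one_pow_card_eq]
  exact_mod_cast h2

/-- Since the last coefficients all agree, their alternating sum is, up to sign, any one of them. -/
lemma alternatingTightSum_eq (p : ℕ) [Fact p.Prime] [CharP k p] {d : ℕ} (hd : 1 ≤ d)
    (hcard : ∀ σ, IsFaceOrEmpty Δ σ → σ.card ≤ d)
    {I : Fin d → Ideal (StanleyReisnerRing k Δ)} (hle : ∀ i, I i ≤ srMaxIdeal k Δ)
    (hsup : ∀ i F, IsFaceOrEmpty Δ F → srMaxIdeal k Δ ≤ I i ⊔ faceIdeal k Δ F) :
    alternatingTightSum p I = simplicialEulerChar Δ - 1 := by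
  classical
  have h1 : alternatingTightSum p I = ∑ T ∈ Finset.univ.filter
      (fun T : Finset (Fin d) => T.Nonempty), (-1) ^ T.card * (1 - simplicialEulerChar Δ) := by
    rw [alternatingTightSum]
    refine Finset.sum_congr ?_ fun T hT => ?_
    · ext; simp
    · rw [(tightHilbertCoeffs_prod p hcard hle hsup T (Finset.mem_filter.1 hT).2).2, ← mul_assoc]
      congr 1
      have hTd : T.card ≤ d := by simpa using T.card_le_univ
      obtain ⟨m, hm⟩ := Nat.exists_eq_add_of_le hTd
      have hs : d - T.card = m := by omega
      have hp : (-1 : ℤ) ^ d = (-1) ^ T.card * (-1) ^ m := by rw [← pow_add, ← hm]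
      rw [hs, hp, mul_left_comm, ← mul_pow]
      simp
  have h2 : ∑ T : Finset (Fin d), (-1 : ℤ) ^ T.card = 0 := by
    have := Finset.sum_powerset_neg_one_pow_card_of_nonempty (x := (Finset.univ : Finset (Fin d)))
      ⟨⟨0, hd⟩, Finset.mem_univ _⟩
    simpa using this
  have h3 : ∑ T ∈ Finset.univ.filter (fun T : Finset (Fin d) => T.Nonempty), (-1 : ℤ) ^ T.card =
      -1 := by
    have hset : (Finset.univ : Finset (Finset (Fin d))) =
        insert ∅ (Finset.univ.filter fun T : Finset (Fin d) => T.Nonempty) := by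
      ext T
      simp [T.eq_empty_or_nonempty]
    rw [hset, Finset.sum_insert (by simp)] at h2
    simp only [Finset.card_empty, pow_zero] at h2
    linarith
  rw [h1, ← Finset.sum_mul, h3]
  ring

end TightHilbert

/-! ### Dimension -/

section Dimension

variable {k : Type*} [Field k] {V : Type*} {Δ : AbstractSimplicialComplex V}

lemma faceIdeal_empty : faceIdeal k Δ ∅ = srMaxIdeal k Δ := by
  simp [faceIdeal, srMaxIdeal]

lemma isPrime_faceIdeal {σ : Finset V} (h : IsFaceOrEmpty Δ σ) : (faceIdeal k Δ σ).IsPrime :=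
  ker_faceMap (k := k) h ▸ isPrime_ker_faceMap h

variable (k Δ) in
lemma srMaxIdeal_ne_top : srMaxIdeal k Δ ≠ ⊤ :=
  faceIdeal_empty (k := k) (Δ := Δ) ▸ (isPrime_faceIdeal (Or.inl rfl)).ne_top

instance isMaximal_srMaxIdeal : (srMaxIdeal k Δ).IsMaximal := by
  rw [Ideal.isMaximal_iff]
  refine ⟨(Ideal.ne_top_iff_one _).1 (srMaxIdeal_ne_top k Δ), fun J x hJ hx hxJ => ?_⟩
  obtain ⟨c, hc⟩ := exists_sub_algebraMap_mem_srMaxIdeal x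
  have hc0 : c ≠ 0 := by
    rintro rfl
    rw [map_zero, sub_zero] at hc
    exact hx hc
  have h1 : algebraMap k _ c ∈ J := by
    have := J.sub_mem hxJ (hJ hc)
    rwa [sub_sub_cancel] at this
  have h2 := J.mul_mem_left (algebraMap k _ c⁻¹) h1
  rwa [← map_mul, inv_mul_cancel₀ hc0, map_one] at h2

/-- Removing the vertices of a face one at a time gives a chain of prime ideals. -/
lemma card_le_height_faceIdeal_sdiff [DecidableEq V] {σ : Finset V} (h : IsFaceOrEmpty Δ σ)
    (ρ : Finset V) (hρ : ρ ⊆ σ) : (ρ.card : ℕ∞) ≤ (faceIdeal k Δ (σ \ ρ)).height := by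
  induction ρ using Finset.induction_on with
  | empty => simp
  | insert a ρ ha ih =>
    have haσ : a ∈ σ := hρ (Finset.mem_insert_self _ _)
    have h1 : IsFaceOrEmpty Δ (σ \ ρ) := h.mono Finset.sdiff_subset
    have h2 : IsFaceOrEmpty Δ (σ \ insert a ρ) := h.mono Finset.sdiff_subset
    have := isPrime_faceIdeal (k := k) h1
    have := isPrime_faceIdeal (k := k) h2
    have hlt : faceIdeal k Δ (σ \ ρ) < faceIdeal k Δ (σ \ insert a ρ) := by
      rw [SetLike.lt_iff_le_and_exists]
      refine ⟨Ideal.span_mono (Set.image_mono fun i hi hi' => hi ?_), srVar k Δ a,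
        Ideal.subset_span ⟨a, by simp, rfl⟩, fun hmem => ?_⟩
      · exact Finset.sdiff_subset_sdiff subset_rfl (Finset.subset_insert a ρ) hi'
      · rw [← ker_faceMap h1, RingHom.mem_ker, faceMap_srVar,
          if_pos (Finset.mem_sdiff.2 ⟨haσ, ha⟩)] at hmem
        exact MvPolynomial.X_ne_zero a hmem
    rw [Finset.card_insert_of_notMem ha, Nat.cast_add, Nat.cast_one]
    exact (add_le_add_left (ih fun i hi => hρ (Finset.mem_insert_of_mem hi)) 1).trans
      (Ideal.height_add_one_le_of_lt_of_isPrime hlt)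

lemma card_le_height_srMaxIdeal {σ : Finset V} (h : IsFaceOrEmpty Δ σ) :
    (σ.card : ℕ∞) ≤ (srMaxIdeal k Δ).height := by
  classical
  simpa [faceIdeal_empty] using card_le_height_faceIdeal_sdiff (k := k) h σ subset_rfl

lemma card_le_of_ringKrullDim_eq {d : ℕ} (hdim : ringKrullDim (StanleyReisnerRing k Δ) = d)
    {σ : Finset V} (h : IsFaceOrEmpty Δ σ) : σ.card ≤ d := by
  have h1 := Ideal.height_le_ringKrullDim_of_ne_top (srMaxIdeal_ne_top k Δ)
  rw [hdim] at h1
  have h2 : (srMaxIdeal k Δ).height ≤ (d : ℕ∞) := by exact_mod_cast h1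
  exact_mod_cast (card_le_height_srMaxIdeal (k := k) h).trans h2

lemma ringKrullDim_quot_faceIdeal_le (σ : Finset V) :
    ringKrullDim (StanleyReisnerRing k Δ ⧸ faceIdeal k Δ σ) ≤ σ.card := by
  classical
  set A := StanleyReisnerRing k Δ ⧸ faceIdeal k Δ σ
  let α : MvPolynomial V k →ₐ[k] A := (Ideal.Quotient.mkₐ k (faceIdeal k Δ σ)).comp
    (Ideal.Quotient.mkₐ k (stanleyReisnerIdeal k Δ))
  let β : MvPolynomial σ k →ₐ[k] A := MvPolynomial.aeval fun i : σ => α (MvPolynomial.X (i : V))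
  let γ : MvPolynomial V k →ₐ[k] MvPolynomial σ k :=
    MvPolynomial.aeval fun i => if h : i ∈ σ then MvPolynomial.X ⟨i, h⟩ else 0
  have hα : Function.Surjective α :=
    Ideal.Quotient.mk_surjective.comp Ideal.Quotient.mk_surjective
  have hβγ : β.comp γ = α := by
    refine MvPolynomial.algHom_ext fun i => ?_
    rw [AlgHom.comp_apply, MvPolynomial.aeval_X]
    split_ifs with h
    · rw [MvPolynomial.aeval_X]
    · rw [map_zero]
      have hi : srVar k Δ i ∈ faceIdeal k Δ σ := Ideal.subset_span ⟨i, h, rfl⟩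
      exact (Ideal.Quotient.eq_zero_iff_mem.2 hi).symm
  have hβ : Function.Surjective β := fun y => by
    obtain ⟨x, rfl⟩ := hα y
    exact ⟨γ x, by rw [← hβγ]; rfl⟩
  refine (ringKrullDim_le_of_surjective β.toRingHom hβ).trans ?_
  rw [MvPolynomial.ringKrullDim_of_isNoetherianRing, ringKrullDim_eq_zero_of_field]
  simp

/-- The dimension of `k[Δ]` is attained on a facet, as every prime ideal contains the prime ideal of
a facet. -/
lemma exists_face_card_eq [Fintype V] {d : ℕ} (hdim : ringKrullDim (StanleyReisnerRing k Δ) = d) :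
    ∃ σ, IsFaceOrEmpty Δ σ ∧ σ.card = d := by
  by_contra! hcon
  have hlt : ∀ σ, IsFaceOrEmpty Δ σ → σ.card + 1 ≤ d := fun σ hσ =>
    Nat.succ_le_of_lt (lt_of_le_of_ne (card_le_of_ringKrullDim_eq hdim hσ) (hcon σ hσ))
  have hd1 : 1 ≤ d := (Nat.le_add_left 1 _).trans (hlt ∅ (Or.inl rfl))
  have hle : ringKrullDim (StanleyReisnerRing k Δ) ≤ ((d - 1 : ℕ) : WithBot ℕ∞) := by
    rw [ringKrullDim, Order.krullDim]
    refine iSup_le fun s => ?_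
    obtain ⟨F, hF, hle⟩ := exists_faceIdeal_le_of_isPrime s.head.asIdeal
    let t : LTSeries (PrimeSpectrum.zeroLocus (R := StanleyReisnerRing k Δ) (faceIdeal k Δ F)) :=
      LTSeries.mk s.length (fun i => ⟨s i, hle.trans (s.monotone (Fin.zero_le i))⟩)
        (fun i j hij => s.strictMono hij)
    have h1 : (s.length : WithBot ℕ∞) ≤ _ := Order.LTSeries.length_le_krullDim t
    rw [← ringKrullDim_quotient] at h1
    refine h1.trans ((ringKrullDim_quot_faceIdeal_le F).trans ?_)
    have := hlt F hF.1
    exact_mod_cast (by omega : F.card ≤ d - 1)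
  rw [hdim] at hle
  have : d ≤ d - 1 := by exact_mod_cast hle
  omega

lemma height_srMaxIdeal_eq [Fintype V] {d : ℕ} (hdim : ringKrullDim (StanleyReisnerRing k Δ) = d) :
    (srMaxIdeal k Δ).height = d := by
  obtain ⟨σ, hσ, rfl⟩ := exists_face_card_eq hdim
  refine le_antisymm ?_ (card_le_height_srMaxIdeal hσ)
  have h1 := Ideal.height_le_ringKrullDim_of_ne_top (srMaxIdeal_ne_top k Δ)
  rw [hdim] at h1
  exact_mod_cast h1

end Dimension

/-! ### Hilbert functions of homogeneous ideals -/

section Homogeneous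

open MvPolynomial

variable {k : Type*} [Field k] {V : Type*}

/-- An ideal of a polynomial ring is graded if it contains the homogeneous components of its
elements. -/
def IsGradedIdeal (K : Ideal (MvPolynomial V k)) : Prop :=
  ∀ f ∈ K, ∀ n, homogeneousComponent n f ∈ K

lemma homogeneousComponent_eq_zero_of_mem_pow {n : ℕ} {f : MvPolynomial V k}
    (hf : f ∈ idealOfVars V k ^ (n + 1)) : homogeneousComponent n f = 0 := by
  ext m
  rw [coeff_homogeneousComponent, coeff_zero]
  split_ifs with h
  · exact (mem_pow_idealOfVars_iff' _ _).1 hf m (by omega)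
  · rfl

/-- Elements with nonzero constant term are nonzerodivisors modulo graded ideals. -/
lemma IsGradedIdeal.mem_of_mul_mem {K : Ideal (MvPolynomial V k)} (hK : IsGradedIdeal K)
    {s f : MvPolynomial V k} (hs : s.coeff 0 ≠ 0) (h : s * f ∈ K) : f ∈ K := by
  set t : MvPolynomial V k := 1 - C (s.coeff 0)⁻¹ * s with ht
  have htv : t ∈ idealOfVars V k := by
    rw [← pow_one (idealOfVars V k), mem_pow_idealOfVars_iff']
    intro m hm
    have hm0 : m = 0 := by
      rw [← Finsupp.degree_eq_zero_iff]; omega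
    subst hm0
    simp [ht, hs]
  have hstep : ∀ N : ℕ, f - t ^ N * f ∈ K := by
    intro N
    induction N with
    | zero => simp
    | succ N ih =>
      have e : f - t ^ (N + 1) * f = (f - t ^ N * f) + t ^ N * C (s.coeff 0)⁻¹ * (s * f) := by
        rw [pow_succ, ht]; ring
      rw [e]
      exact K.add_mem ih (K.mul_mem_left _ h)
  have hcomp : ∀ n, homogeneousComponent n f ∈ K := by
    intro n
    have h1 := hK _ (hstep (n + 1)) n
    rwa [map_sub, homogeneousComponent_eq_zero_of_mem_pow (Ideal.mul_mem_right _ _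
      (Ideal.pow_mem_pow htv (n + 1))), sub_zero] at h1
  rw [← sum_homogeneousComponent f]
  exact K.sum_mem fun n _ => hcomp n

lemma homogeneousComponent_mul_succ {g : MvPolynomial V k} (hg : g.IsHomogeneous 1)
    (h : MvPolynomial V k) (n : ℕ) :
    homogeneousComponent (n + 1) (g * h) = g * homogeneousComponent n h := by
  conv_lhs => rw [← sum_homogeneousComponent h]
  rw [Finset.mul_sum, map_sum]
  have h1 : ∀ i, homogeneousComponent (n + 1) (g * homogeneousComponent i h) =
      if i = n then g * homogeneousComponent i h else 0 := by
    intro i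
    have := homogeneousComponent_of_mem (m := n + 1)
      ((mem_homogeneousSubmodule _ _).2 (hg.mul (homogeneousComponent_isHomogeneous i h)))
    rw [this]
    congr 1
    rw [eq_iff_iff]
    omega
  rw [Finset.sum_congr rfl fun i _ => h1 i, Finset.sum_ite_eq']
  split_ifs with hn
  · rfl
  · rw [homogeneousComponent_eq_zero, mul_zero]
    simpa using hn

lemma homogeneousComponent_mul_zero {g : MvPolynomial V k} (hg : g.IsHomogeneous 1)
    (h : MvPolynomial V k) : homogeneousComponent 0 (g * h) = 0 := by
  have : g.coeff 0 = 0 := hg.coeff_eq_zero (by simp)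
  rw [homogeneousComponent_zero, ← constantCoeff_eq, map_mul, constantCoeff_eq, this]
  simp

/-- The elements of degree `n + 1` of `K + (g)`, where `g` is a linear form. -/
lemma IsGradedIdeal.exists_of_mem_sup {K : Ideal (MvPolynomial V k)} (hK : IsGradedIdeal K)
    {g : MvPolynomial V k} (hg : g.IsHomogeneous 1) {f : MvPolynomial V k}
    (hf : f ∈ K ⊔ Ideal.span {g}) (n : ℕ) : ∃ a ∈ K, ∃ h : MvPolynomial V k,
      a.IsHomogeneous (n + 1) ∧ h.IsHomogeneous n ∧
        homogeneousComponent (n + 1) f = a + g * h := by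
  obtain ⟨a, ha, b, hb, rfl⟩ := Submodule.mem_sup.1 hf
  obtain ⟨h, rfl⟩ := Ideal.mem_span_singleton'.1 hb
  refine ⟨_, hK a ha (n + 1), _, homogeneousComponent_isHomogeneous _ _,
    homogeneousComponent_isHomogeneous n h, ?_⟩
  rw [map_add, mul_comm, homogeneousComponent_mul_succ hg]

lemma IsGradedIdeal.homogeneousComponent_zero_mem {K : Ideal (MvPolynomial V k)}
    (hK : IsGradedIdeal K) {g : MvPolynomial V k} (hg : g.IsHomogeneous 1) {f : MvPolynomial V k}
    (hf : f ∈ K ⊔ Ideal.span {g}) : homogeneousComponent 0 f ∈ K := by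
  obtain ⟨a, ha, b, hb, rfl⟩ := Submodule.mem_sup.1 hf
  obtain ⟨h, rfl⟩ := Ideal.mem_span_singleton'.1 hb
  rw [map_add, mul_comm, homogeneousComponent_mul_zero hg, add_zero]
  exact hK a ha 0

lemma IsGradedIdeal.sup_span_singleton {K : Ideal (MvPolynomial V k)} (hK : IsGradedIdeal K)
    {g : MvPolynomial V k} (hg : g.IsHomogeneous 1) : IsGradedIdeal (K ⊔ Ideal.span {g}) := by
  rintro f hf (_ | n)
  · exact Ideal.mem_sup_left (hK.homogeneousComponent_zero_mem hg hf)
  · obtain ⟨a, ha, h, -, -, e⟩ := hK.exists_of_mem_sup hg hf n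
    rw [e]
    exact Ideal.add_mem _ (Ideal.mem_sup_left ha)
      (Ideal.mem_sup_right (Ideal.mul_mem_right _ _ (Ideal.mem_span_singleton_self g)))

/-- The elements of degree `n` of an ideal. -/
def gradedPiece (K : Ideal (MvPolynomial V k)) (n : ℕ) : Submodule k (MvPolynomial V k) :=
  homogeneousSubmodule V k n ⊓ K.restrictScalars k

lemma mem_gradedPiece {K : Ideal (MvPolynomial V k)} {n : ℕ} {f : MvPolynomial V k} :
    f ∈ gradedPiece K n ↔ f.IsHomogeneous n ∧ f ∈ K := by
  rw [gradedPiece, Submodule.mem_inf, mem_homogeneousSubmodule, Submodule.restrictScalars_mem]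

instance finite_homogeneousSubmodule [Finite V] (n : ℕ) :
    Module.Finite k (homogeneousSubmodule V k n) :=
  Module.Finite.iff_fg.2 (homogeneousSubmodule_fg V k n)

instance finite_gradedPiece [Finite V] (K : Ideal (MvPolynomial V k)) (n : ℕ) :
    Module.Finite k (gradedPiece K n) := by
  unfold gradedPiece
  infer_instance

/-- The Hilbert function of the quotient by a graded ideal. -/
def hilbertFn (K : Ideal (MvPolynomial V k)) (n : ℕ) : ℤ :=
  (Module.finrank k (homogeneousSubmodule V k n) : ℤ) - Module.finrank k (gradedPiece K n)

lemma hilbertFn_eq_zero_iff [Finite V] {K : Ideal (MvPolynomial V k)} {n : ℕ} :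
    hilbertFn K n = 0 ↔ ∀ f : MvPolynomial V k, f.IsHomogeneous n → f ∈ K := by
  rw [hilbertFn, sub_eq_zero]
  constructor
  · intro h f hf
    have heq : gradedPiece K n = homogeneousSubmodule V k n :=
      Submodule.eq_of_le_of_finrank_eq inf_le_left (by exact_mod_cast h.symm)
    have : f ∈ gradedPiece K n := heq ▸ (mem_homogeneousSubmodule n f).2 hf
    exact (mem_gradedPiece.1 this).2
  · intro h
    have heq : gradedPiece K n = homogeneousSubmodule V k n :=
      le_antisymm inf_le_left fun f hf => mem_gradedPiece.2
        ⟨(mem_homogeneousSubmodule n f).1 hf, h f ((mem_homogeneousSubmodule n f).1 hf)⟩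
    rw [heq]

lemma hilbertFn_sup_zero {K : Ideal (MvPolynomial V k)} (hK : IsGradedIdeal K)
    {g : MvPolynomial V k} (hg : g.IsHomogeneous 1) :
    hilbertFn (K ⊔ Ideal.span {g}) 0 = hilbertFn K 0 := by
  have : gradedPiece (K ⊔ Ideal.span {g}) 0 = gradedPiece K 0 := by
    ext f
    rw [mem_gradedPiece, mem_gradedPiece]
    refine and_congr_right fun hf => ⟨fun h => ?_, fun h => Ideal.mem_sup_left h⟩
    have h1 := hK.homogeneousComponent_zero_mem hg h
    rwa [homogeneousComponent_eq_self hf] at h1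
  rw [hilbertFn, hilbertFn, this]

/-- Dividing by a linear form that is a nonzerodivisor takes the first difference of the Hilbert
function. -/
lemma hilbertFn_sup_succ [Finite V] {K : Ideal (MvPolynomial V k)} (hK : IsGradedIdeal K)
    (hKtop : K ≠ ⊤)
    {g : MvPolynomial V k} (hg : g.IsHomogeneous 1) (hreg : ∀ f, g * f ∈ K → f ∈ K) (n : ℕ) :
    hilbertFn (K ⊔ Ideal.span {g}) (n + 1) = hilbertFn K (n + 1) - hilbertFn K n := by
  have hg0 : g ≠ 0 := by
    rintro rfl
    exact hKtop ((Ideal.eq_top_iff_one K).2 (hreg 1 (by simp)))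
  have hinj : Function.Injective (LinearMap.mulLeft k g) := fun x y hxy =>
    mul_left_cancel₀ hg0 hxy
  set B := (homogeneousSubmodule V k n).map (LinearMap.mulLeft k g) with hB
  have h1 : gradedPiece (K ⊔ Ideal.span {g}) (n + 1) = gradedPiece K (n + 1) ⊔ B := by
    apply le_antisymm
    · intro f hf
      obtain ⟨hfh, hfK⟩ := mem_gradedPiece.1 hf
      obtain ⟨a, ha, h, hah, hhh, e⟩ := hK.exists_of_mem_sup hg hfK n
      rw [homogeneousComponent_eq_self hfh] at e
      rw [e]
      exact Submodule.add_mem_sup (mem_gradedPiece.2 ⟨hah, ha⟩)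
        (Submodule.mem_map.2 ⟨h, (mem_homogeneousSubmodule n h).2 hhh, rfl⟩)
    · refine sup_le ?_ ?_
      · intro f hf
        obtain ⟨hfh, hfK⟩ := mem_gradedPiece.1 hf
        exact mem_gradedPiece.2 ⟨hfh, Ideal.mem_sup_left hfK⟩
      · rintro _ ⟨h, hh, rfl⟩
        refine mem_gradedPiece.2 ⟨?_, Ideal.mem_sup_right
          (Ideal.mul_mem_right _ _ (Ideal.mem_span_singleton_self g))⟩
        rw [add_comm n 1]
        exact hg.mul ((mem_homogeneousSubmodule n h).1 hh)
  have h2 : gradedPiece K (n + 1) ⊓ B = (gradedPiece K n).map (LinearMap.mulLeft k g) := by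
    ext f
    constructor
    · rintro ⟨hf, h, hh, rfl⟩
      exact ⟨h, mem_gradedPiece.2 ⟨(mem_homogeneousSubmodule n h).1 hh,
        hreg h (mem_gradedPiece.1 hf).2⟩, rfl⟩
    · rintro ⟨h, hh, rfl⟩
      obtain ⟨hhh, hhK⟩ := mem_gradedPiece.1 hh
      refine ⟨mem_gradedPiece.2 ⟨?_, Ideal.mul_mem_left _ _ hhK⟩, h,
        (mem_homogeneousSubmodule n h).2 hhh, rfl⟩
      rw [add_comm n 1]
      exact hg.mul hhh
  have h3 := Submodule.finrank_sup_add_finrank_inf_eq (gradedPiece K (n + 1)) B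
  have h4 : Module.finrank k B = Module.finrank k (homogeneousSubmodule V k n) :=
    ((homogeneousSubmodule V k n).equivMapOfInjective _ hinj).finrank_eq.symm
  have h5 : Module.finrank k ((gradedPiece K n).map (LinearMap.mulLeft k g)) =
      Module.finrank k (gradedPiece K n) :=
    ((gradedPiece K n).equivMapOfInjective _ hinj).finrank_eq.symm
  rw [← h1, h2, h4, h5] at h3
  simp only [hilbertFn]
  omega

/-- The Hilbert series of the quotient by a graded ideal. -/
def hilbertSer (K : Ideal (MvPolynomial V k)) : PowerSeries ℤ := PowerSeries.mk (hilbertFn K)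

lemma hilbertSer_sup [Finite V] {K : Ideal (MvPolynomial V k)} (hK : IsGradedIdeal K)
    (hKtop : K ≠ ⊤)
    {g : MvPolynomial V k} (hg : g.IsHomogeneous 1) (hreg : ∀ f, g * f ∈ K → f ∈ K) :
    hilbertSer (K ⊔ Ideal.span {g}) = (1 - PowerSeries.X) * hilbertSer K := by
  ext n
  rw [sub_mul, one_mul, map_sub, hilbertSer, hilbertSer, PowerSeries.coeff_mk]
  rcases n with _ | n
  · simp [hilbertFn_sup_zero hK hg]
  · rw [PowerSeries.coeff_succ_X_mul, PowerSeries.coeff_mk, PowerSeries.coeff_mk,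
      hilbertFn_sup_succ hK hKtop hg hreg]

end Homogeneous

/-! ### Linear systems of parameters and the Hilbert series -/

section LinearParameters

open MvPolynomial

variable {k : Type*} [Field k] {V : Type*} {Δ : AbstractSimplicialComplex V}

lemma isGradedIdeal_stanleyReisnerIdeal : IsGradedIdeal (stanleyReisnerIdeal k Δ) := by
  intro f hf n
  rw [mem_stanleyReisnerIdeal_iff] at hf ⊢
  intro m hm
  refine hf m ?_
  rw [mem_support_iff, coeff_homogeneousComponent] at hm
  rw [mem_support_iff]
  exact fun h => hm (by rw [h, ite_self])

variable (k Δ) in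
lemma hilbertFn_stanleyReisnerIdeal [Fintype V] [DecidableEq V] (n : ℕ) :
    hilbertFn (stanleyReisnerIdeal k Δ) n =
      ∑ σ ∈ facesWithEmpty Δ, ((exponentsOn σ n).card : ℤ) := by
  classical
  set S : Finset (V →₀ ℕ) := (facesWithEmpty Δ).biUnion fun σ => exponentsOn σ n with hS
  have hmemS : ∀ m, m ∈ S ↔ IsFaceOrEmpty Δ m.support ∧ m.degree = n := by
    intro m
    simp only [hS, Finset.mem_biUnion, mem_facesWithEmpty, mem_exponentsOn]
    exact ⟨fun ⟨σ, h, h1, h2⟩ => ⟨h1 ▸ h, h2⟩, fun ⟨h, h1⟩ => ⟨_, h, rfl, h1⟩⟩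
  have hcard : S.card = ∑ σ ∈ facesWithEmpty Δ, (exponentsOn σ n).card := by
    rw [hS, Finset.card_biUnion]
    intro σ _ τ _ hne
    rw [Function.onFun, Finset.disjoint_left]
    intro m hm hm'
    exact hne ((mem_exponentsOn.1 hm).1.symm.trans (mem_exponentsOn.1 hm').1)
  let g : homogeneousSubmodule V k n →ₗ[k] (S → k) :=
    (LinearMap.pi fun m : S => lcoeff k (m : V →₀ ℕ)).domRestrict _
  have hg : ∀ f m, g f m = (f : MvPolynomial V k).coeff (m : V →₀ ℕ) := fun _ _ => rfl
  have hsurj : Function.Surjective g := by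
    intro w
    refine ⟨⟨∑ m : S, monomial (m : V →₀ ℕ) (w m), ?_⟩, ?_⟩
    · exact Submodule.sum_mem _ fun m _ => isHomogeneous_monomial _ ((hmemS m).1 m.2).2
    · ext m
      rw [hg]
      simp [coeff_sum, coeff_monomial]
  have hker : LinearMap.ker g =
      (gradedPiece (stanleyReisnerIdeal k Δ) n).comap (homogeneousSubmodule V k n).subtype := by
    ext ⟨f, hf⟩
    rw [LinearMap.mem_ker, Submodule.mem_comap, Submodule.subtype_apply, mem_gradedPiece,
      mem_stanleyReisnerIdeal_iff]
    rw [mem_homogeneousSubmodule] at hf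
    constructor
    · refine fun h => ⟨hf, fun m hm hface => mem_support_iff.1 hm ?_⟩
      have hdeg : m.degree = n := by
        by_contra hne
        exact mem_support_iff.1 hm (hf.coeff_eq_zero hne)
      exact congrFun h ⟨m, (hmemS m).2 ⟨hface, hdeg⟩⟩
    · rintro ⟨-, h⟩
      ext ⟨m, hm⟩
      rw [hg]
      by_contra hne
      exact h m (mem_support_iff.2 hne) ((hmemS m).1 hm).1
  have hle : gradedPiece (stanleyReisnerIdeal k Δ) n ≤ homogeneousSubmodule V k n := inf_le_left
  have h1 := LinearMap.finrank_range_add_finrank_ker g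
  rw [LinearMap.range_eq_top.2 hsurj, finrank_top, Module.finrank_fintype_fun_eq_card,
    Fintype.card_coe, hker, (Submodule.comapSubtypeEquivOfLe hle).finrank_eq] at h1
  rw [hilbertFn, ← h1, hcard]
  push_cast
  ring

/-- Multiplying the Hilbert series of `k[Δ]` by `(1 - X) ^ d` clears all denominators. -/
lemma one_sub_X_pow_mul_hilbertSer [Fintype V] {d : ℕ}
    (hcard : ∀ σ, IsFaceOrEmpty Δ σ → σ.card ≤ d) :
    (1 - PowerSeries.X) ^ d * hilbertSer (stanleyReisnerIdeal k Δ) =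
      ∑ σ ∈ facesWithEmpty Δ, PowerSeries.X ^ σ.card * (1 - PowerSeries.X) ^ (d - σ.card) := by
  classical
  have h1 : hilbertSer (stanleyReisnerIdeal k Δ) = ∑ σ ∈ facesWithEmpty Δ,
      PowerSeries.mk fun n => ((exponentsOn σ n).card : ℤ) := by
    ext n
    rw [hilbertSer, PowerSeries.coeff_mk, hilbertFn_stanleyReisnerIdeal, map_sum]
    simp
  rw [h1, Finset.mul_sum]
  refine Finset.sum_congr rfl fun σ hσ => ?_
  rw [← one_sub_X_pow_mul_mk_card_exponentsOn σ, mul_right_comm, ← pow_add,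
    Nat.add_sub_cancel' (hcard σ (mem_facesWithEmpty.1 hσ))]

lemma mk_mem_srMaxIdeal_pow {n : ℕ} {f : MvPolynomial V k} (hf : f.IsHomogeneous n) :
    Ideal.Quotient.mk (stanleyReisnerIdeal k Δ) f ∈ srMaxIdeal k Δ ^ n := by
  rw [mk_mem_srMaxIdeal_pow_iff]
  intro m hm _
  by_contra hlt
  exact mem_support_iff.1 hm (hf.coeff_eq_zero (by omega))

lemma srMaxIdeal_pow_le_of_isHomogeneous {n : ℕ} {K : Ideal (StanleyReisnerRing k Δ)}
    (h : ∀ f : MvPolynomial V k, f.IsHomogeneous n →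
      Ideal.Quotient.mk (stanleyReisnerIdeal k Δ) f ∈ K) : srMaxIdeal k Δ ^ n ≤ K := by
  rw [srMaxIdeal_eq_map, ← Ideal.map_pow, pow_idealOfVars_eq_span, Ideal.map_span, Ideal.span_le]
  rintro _ ⟨_, ⟨m, hm, rfl⟩, rfl⟩
  exact h _ (isHomogeneous_monomial _ hm)

lemma exists_isHomogeneous_mk_eq {l : StanleyReisnerRing k Δ} (hl : l ∈ linearForms k Δ) :
    ∃ f : MvPolynomial V k, f.IsHomogeneous 1 ∧
      Ideal.Quotient.mk (stanleyReisnerIdeal k Δ) f = l := by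
  induction hl using Submodule.span_induction with
  | mem x hx =>
    obtain ⟨i, rfl⟩ := hx
    exact ⟨X i, isHomogeneous_X _ i, rfl⟩
  | zero => exact ⟨0, isHomogeneous_zero _ _ _, map_zero _⟩
  | add x y _ _ hx hy =>
    obtain ⟨f, hf, rfl⟩ := hx
    obtain ⟨g, hg, rfl⟩ := hy
    exact ⟨f + g, hf.add hg, map_add _ _ _⟩
  | smul c x _ hx =>
    obtain ⟨f, hf, rfl⟩ := hx
    exact ⟨c • f, (homogeneousSubmodule V k 1).smul_mem c hf, rfl⟩

/-- In a Cohen–Macaulay Stanley–Reisner ring, linear forms `b_1, …, b_d` that generate an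
`𝔪`-primary ideal form a regular sequence, at least locally at `𝔪`. -/
lemma LinearPartsSpan.exists_notMem_mul_mem [Fintype V] {d : ℕ}
    (hdim : ringKrullDim (StanleyReisnerRing k Δ) = d)
    (hCM : IsCohenMacaulay (StanleyReisnerRing k Δ)) {b : Fin d → StanleyReisnerRing k Δ}
    (hb : ∀ i, b i ∈ linearForms k Δ) (hL : LinearPartsSpan (Set.range b)) (i : Fin d)
    {f : StanleyReisnerRing k Δ} (hf : b i * f ∈ Ideal.span (b '' {j | j < i})) :
    ∃ s ∉ srMaxIdeal k Δ, s * f ∈ Ideal.span (b '' {j | j < i}) := by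
  have := hCM.1
  let A := Localization.AtPrime (srMaxIdeal k Δ)
  let φ := algebraMap (StanleyReisnerRing k Δ) A
  obtain ⟨rs, hreg, hlen⟩ : IsCohenMacaulayLocal A := hCM.2 (srMaxIdeal k Δ)
  have : IsNoetherianRing A := IsLocalization.isNoetherianRing (srMaxIdeal k Δ).primeCompl A hCM.1
  have hlen' : rs.length = d := by
    rw [IsLocalization.AtPrime.ringKrullDim_eq_height (srMaxIdeal k Δ) A,
      height_srMaxIdeal_eq hdim] at hlen
    exact_mod_cast hlen
  obtain ⟨N, hN⟩ := hL.exists_pow_succ_le (by rintro _ ⟨j, rfl⟩; exact hb j)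
  have hys : RingTheory.Sequence.IsRegular A (List.ofFn fun j => φ (b j)) := by
    refine IsLocalRing.isRegular_of_forall_isPrime_eq_maximalIdeal d A rs _ hreg hlen'
      (List.length_ofFn) ?_ ?_
    · intro y hy
      obtain ⟨j, rfl⟩ := (List.mem_ofFn' _ _).1 hy
      exact (IsLocalization.AtPrime.to_map_mem_maximal_iff A (srMaxIdeal k Δ) (b j)).2
        (linearForms_le_srMaxIdeal (hb j))
    · intro P hP hle _
      have h1 : Ideal.span (Set.range b) ≤ P.comap φ := by
        rw [Ideal.span_le]
        rintro _ ⟨j, rfl⟩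
        exact hle (Ideal.subset_span ((List.mem_ofFn' _ _).2 ⟨j, rfl⟩))
      have h2 : srMaxIdeal k Δ ≤ P.comap φ :=
        Ideal.IsPrime.le_of_pow_le (hN.trans (Ideal.mul_le_left.trans h1))
      apply le_antisymm (IsLocalRing.le_maximalIdeal hP.ne_top)
      rw [← Localization.AtPrime.map_eq_maximalIdeal]
      exact Ideal.map_le_iff_le_comap.2 h2
  have hofList : Ideal.ofList ((List.ofFn fun j => φ (b j)).take i) =
      (Ideal.span (b '' {j | j < i})).map φ := by
    rw [Ideal.map_span, Ideal.ofList]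
    congr 1
    ext y
    simp only [Set.mem_ofPred_eq, List.mem_take_iff_getElem, List.getElem_ofFn, Set.mem_image]
    constructor
    · rintro ⟨j, hj, rfl⟩
      have hj' : j < i.val := by simpa using hj
      exact ⟨_, ⟨⟨j, hj'.trans i.2⟩, hj', rfl⟩, rfl⟩
    · rintro ⟨_, ⟨j, hj, rfl⟩, rfl⟩
      exact ⟨j, by simpa using Fin.lt_def.1 hj, rfl⟩
  have h3 := (RingTheory.Sequence.isWeaklyRegular_iff_Fin _ _).1 hys.toIsWeaklyRegular
    ⟨i, by simp⟩
  have h4 := (isSMulRegular_quotient_iff_mem_of_smul_mem _ _).1 h3 (φ f) (by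
    rw [hofList]
    simpa [← map_mul] using Ideal.mem_map_of_mem φ hf)
  rw [hofList] at h4
  have h5 : φ f ∈ (Ideal.span (b '' {j | j < i})).map φ := by simpa using h4
  exact (IsLocalization.algebraMap_mem_map_algebraMap_iff (srMaxIdeal k Δ).primeCompl A _ _).1 h5

end LinearParameters

/-! ### The Euler characteristic and the top degree of the Artinian reduction -/

section EulerCharacteristic

open MvPolynomial

variable {k : Type*} [Field k] {V : Type*} {Δ : AbstractSimplicialComplex V}

variable (Δ) in
/-- The ideal `I_Δ + (g_j : j < n)` of the polynomial ring. -/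
def partialQuotIdeal {d : ℕ} (g : Fin d → MvPolynomial V k) (n : ℕ) : Ideal (MvPolynomial V k) :=
  stanleyReisnerIdeal k Δ ⊔ Ideal.span (g '' {j | (j : ℕ) < n})

lemma mem_partialQuotIdeal {d : ℕ} {g : Fin d → MvPolynomial V k} {n : ℕ}
    {f : MvPolynomial V k} : f ∈ partialQuotIdeal Δ g n ↔
      Ideal.Quotient.mk (stanleyReisnerIdeal k Δ) f ∈ Ideal.span
        ((fun j => Ideal.Quotient.mk (stanleyReisnerIdeal k Δ) (g j)) '' {j | (j : ℕ) < n}) := by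
  rw [partialQuotIdeal, sup_comm, ← Ideal.mem_quotient_iff_mem_sup, Ideal.map_span, Set.image_image]

lemma partialQuotIdeal_zero {d : ℕ} (g : Fin d → MvPolynomial V k) :
    partialQuotIdeal Δ g 0 = stanleyReisnerIdeal k Δ := by
  simp [partialQuotIdeal]

lemma partialQuotIdeal_succ {d : ℕ} (g : Fin d → MvPolynomial V k) (i : Fin d) :
    partialQuotIdeal Δ g (i + 1) = partialQuotIdeal Δ g i ⊔ Ideal.span {g i} := by
  have : {j : Fin d | (j : ℕ) < i + 1} = {j : Fin d | (j : ℕ) < i} ∪ {i} := by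
    ext j
    simp only [Set.mem_ofPred_eq, Set.mem_union, Set.mem_singleton_iff, Fin.ext_iff]
    omega
  rw [partialQuotIdeal, partialQuotIdeal, this, Set.image_union, Set.image_singleton,
    Ideal.span_union, sup_assoc]

lemma partialQuotIdeal_ne_top {d : ℕ} {g : Fin d → MvPolynomial V k}
    (hg : ∀ i, (g i).IsHomogeneous 1) (n : ℕ) : partialQuotIdeal Δ g n ≠ ⊤ := by
  intro h
  have h1 := mem_partialQuotIdeal.1 ((Ideal.eq_top_iff_one _).1 h)
  refine (Ideal.ne_top_iff_one _).1 (srMaxIdeal_ne_top k Δ) ((Ideal.span_le.2 ?_) h1)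
  rintro _ ⟨j, -, rfl⟩
  rw [SetLike.mem_coe, ← pow_one (srMaxIdeal k Δ)]
  exact mk_mem_srMaxIdeal_pow (hg j)

lemma isGradedIdeal_partialQuotIdeal {d : ℕ} {g : Fin d → MvPolynomial V k}
    (hg : ∀ i, (g i).IsHomogeneous 1) {n : ℕ} (hn : n ≤ d) :
    IsGradedIdeal (partialQuotIdeal Δ g n) := by
  induction n with
  | zero => exact partialQuotIdeal_zero (Δ := Δ) g ▸ isGradedIdeal_stanleyReisnerIdeal
  | succ n ih =>
    have := partialQuotIdeal_succ (Δ := Δ) g ⟨n, hn⟩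
    rw [this]
    exact (ih (by omega)).sup_span_singleton (hg _)

/-- A homogeneous element of degree `n + 1` of `I_Δ + (g)` is, modulo `I_Δ`, a combination of the
linear forms `g_i` with coefficients of degree `n`. -/
lemma mk_mem_span_mul_of_mem_partialQuotIdeal {d : ℕ} {g : Fin d → MvPolynomial V k}
    (hg : ∀ i, (g i).IsHomogeneous 1) (n : ℕ) {i : ℕ} (hi : i ≤ d) :
    ∀ f : MvPolynomial V k, f.IsHomogeneous (n + 1) → f ∈ partialQuotIdeal Δ g i →
      Ideal.Quotient.mk (stanleyReisnerIdeal k Δ) f ∈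
        Ideal.span (Set.range fun j => Ideal.Quotient.mk (stanleyReisnerIdeal k Δ) (g j)) *
          srMaxIdeal k Δ ^ n := by
  induction i with
  | zero =>
    intro f _ hf
    rw [partialQuotIdeal_zero] at hf
    rw [Ideal.Quotient.eq_zero_iff_mem.2 hf]
    exact Ideal.zero_mem _
  | succ i ih =>
    intro f hfh hf
    have hsucc := partialQuotIdeal_succ (Δ := Δ) g ⟨i, hi⟩
    rw [hsucc] at hf
    obtain ⟨a, ha, h, hah, hhh, e⟩ := (isGradedIdeal_partialQuotIdeal (Δ := Δ) hg
      (Nat.le_of_succ_le hi)).exists_of_mem_sup (hg ⟨i, hi⟩) hf n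
    rw [homogeneousComponent_eq_self hfh] at e
    rw [e, map_add, map_mul]
    exact Ideal.add_mem _ (ih (Nat.le_of_succ_le hi) a hah ha)
      (Ideal.mul_mem_mul (Ideal.subset_span ⟨_, rfl⟩) (mk_mem_srMaxIdeal_pow hhh))

/-- If the linear forms `b_1, …, b_d` generate an `𝔪`-primary ideal of the Cohen–Macaulay ring
`k[Δ]`, then the Hilbert series of `k[Δ] / (b_1, …, b_d)` is `∑_σ X^|σ| (1 - X)^(d - |σ|)`; its
coefficient at `X ^ d` is `(-1) ^ d * (1 - χ(Δ))`. -/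
theorem LinearPartsSpan.srMaxIdeal_pow_le_iff [Fintype V] {d : ℕ} (hd : 1 ≤ d)
    (hdim : ringKrullDim (StanleyReisnerRing k Δ) = d)
    (hCM : IsCohenMacaulay (StanleyReisnerRing k Δ)) {b : Fin d → StanleyReisnerRing k Δ}
    (hb : ∀ i, b i ∈ linearForms k Δ) (hL : LinearPartsSpan (Set.range b)) :
    srMaxIdeal k Δ ^ d ≤ Ideal.span (Set.range b) * srMaxIdeal k Δ ^ (d - 1) ↔
      simplicialEulerChar Δ = 1 := by
  choose g hg hgb using fun i => exists_isHomogeneous_mk_eq (hb i)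
  obtain rfl : (fun j => Ideal.Quotient.mk (stanleyReisnerIdeal k Δ) (g j)) = b := funext hgb
  have hcard : ∀ σ, IsFaceOrEmpty Δ σ → σ.card ≤ d := fun σ =>
    card_le_of_ringKrullDim_eq hdim
  have hser : ∀ n ≤ d, hilbertSer (partialQuotIdeal Δ g n) =
      (1 - PowerSeries.X) ^ n * hilbertSer (stanleyReisnerIdeal k Δ) := by
    intro n hn
    induction n with
    | zero => rw [partialQuotIdeal_zero, pow_zero, one_mul]
    | succ n ih =>
      have hgr := isGradedIdeal_partialQuotIdeal (Δ := Δ) hg (Nat.le_of_succ_le hn)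
      have hsucc := partialQuotIdeal_succ (Δ := Δ) g ⟨n, hn⟩
      rw [hsucc, hilbertSer_sup hgr (partialQuotIdeal_ne_top hg n) (hg _), ih (by omega),
        ← mul_assoc, ← pow_succ']
      intro f hf
      rw [mem_partialQuotIdeal, map_mul] at hf
      obtain ⟨s, hs, hsf⟩ := hL.exists_notMem_mul_mem hdim hCM hb ⟨n, hn⟩ hf
      obtain ⟨s, rfl⟩ := Ideal.Quotient.mk_surjective s
      refine hgr.mem_of_mul_mem (s := s) (fun h0 => hs ?_) ?_
      · rw [← pow_one (srMaxIdeal k Δ), mk_mem_srMaxIdeal_pow_iff]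
        intro m hm _
        by_contra hlt
        have hm0 : m = 0 := by rw [← Finsupp.degree_eq_zero_iff]; omega
        exact mem_support_iff.1 hm (hm0 ▸ h0)
      · rw [mem_partialQuotIdeal, map_mul]
        exact hsf
  have hcoeff : hilbertFn (partialQuotIdeal Δ g d) d =
      (-1) ^ d * (1 - simplicialEulerChar Δ) := by
    have h1 : hilbertFn (partialQuotIdeal Δ g d) d =
        PowerSeries.coeff d (hilbertSer (partialQuotIdeal Δ g d)) := by
      rw [hilbertSer, PowerSeries.coeff_mk]
    rw [h1, hser d le_rfl, one_sub_X_pow_mul_hilbertSer hcard, map_sum,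
      ← sum_neg_one_pow_card_eq, Finset.mul_sum]
    refine Finset.sum_congr rfl fun σ hσ => ?_
    have hσd := hcard σ (mem_facesWithEmpty.1 hσ)
    rw [coeff_X_pow_mul_one_sub_X_pow hσd, ← pow_add]
    rw [show d + σ.card = (d - σ.card) + 2 * σ.card by omega, pow_add, pow_mul]
    simp
  have hiff : simplicialEulerChar Δ = 1 ↔ hilbertFn (partialQuotIdeal Δ g d) d = 0 := by
    rw [hcoeff, mul_eq_zero, or_iff_right (pow_ne_zero _ (by norm_num)), sub_eq_zero, eq_comm]
  have huniv : ((fun j => Ideal.Quotient.mk (stanleyReisnerIdeal k Δ) (g j)) ''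
      {j : Fin d | (j : ℕ) < d}) =
      Set.range fun j => Ideal.Quotient.mk (stanleyReisnerIdeal k Δ) (g j) := by
    rw [← Set.image_univ]
    congr 1
    ext j
    simp
  rw [hiff, hilbertFn_eq_zero_iff]
  constructor
  · intro hle f hf
    rw [mem_partialQuotIdeal, huniv]
    exact Ideal.mul_le_left (hle (mk_mem_srMaxIdeal_pow hf))
  · intro h
    refine srMaxIdeal_pow_le_of_isHomogeneous fun f hf => ?_
    refine mk_mem_span_mul_of_mem_partialQuotIdeal hg (d - 1) le_rfl f ?_ (h f hf)
    rwa [Nat.sub_add_cancel hd]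

end EulerCharacteristic

/-! ### Reductions of an ideal -/

section Reduction

variable {R : Type*} [CommRing R] {M J J' : Ideal R}

lemma Ideal.pow_succ_le_mul_pow_of_le {m n : ℕ} (h : M ^ (n + 1) ≤ J * M ^ n) (hnm : n ≤ m) :
    M ^ (m + 1) ≤ J * M ^ m := by
  obtain ⟨t, rfl⟩ := Nat.exists_eq_add_of_le hnm
  have := Ideal.mul_mono_left (K := M ^ t) h
  rwa [← pow_add, mul_assoc, ← pow_add, Nat.add_right_comm] at this

/-- A form of Nakayama's lemma for ideals that contain a power of `M`. -/
lemma Ideal.le_of_le_sup_mul {K L : Ideal R} (h : L ≤ K ⊔ M * L) {N : ℕ} (hN : M ^ N * L ≤ K) :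
    L ≤ K := by
  have hstep : ∀ t : ℕ, L ≤ K ⊔ M ^ t * L := by
    intro t
    induction t with
    | zero => simp
    | succ t ih =>
      refine ih.trans (sup_le le_sup_left ((Ideal.mul_mono_right h).trans ?_))
      rw [Ideal.mul_sup, ← mul_assoc, ← pow_succ]
      exact sup_le_sup_right Ideal.mul_le_right _
  exact (hstep N).trans (sup_le le_rfl hN)

lemma Ideal.pow_succ_le_mul_pow_of_le_sup {n K : ℕ} (h : M ^ (n + 1) ≤ J * M ^ n ⊔ M ^ (n + 2))
    (hK : M ^ K ≤ J * M ^ n) : M ^ (n + 1) ≤ J * M ^ n := by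
  refine Ideal.le_of_le_sup_mul (M := M) (N := K) ?_ (Ideal.mul_le_left.trans hK)
  rwa [← pow_succ']

lemma Ideal.span_range_mul_pow_le_sup {ι : Type*} {a b : ι → R} (h : ∀ i, a i - b i ∈ M ^ 2)
    (n : ℕ) :
    Ideal.span (Set.range a) * M ^ n ≤ Ideal.span (Set.range b) * M ^ n ⊔ M ^ (n + 2) := by
  have h1 : Ideal.span (Set.range a) ≤ Ideal.span (Set.range b) ⊔ M ^ 2 := by
    rw [Ideal.span_le]
    rintro _ ⟨i, rfl⟩
    rw [← sub_add_cancel (a i) (b i)]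
    exact Ideal.add_mem _ (Ideal.mem_sup_right (h i))
      (Ideal.mem_sup_left (Ideal.subset_span ⟨i, rfl⟩))
  refine (Ideal.mul_mono_left h1).trans ?_
  rw [Ideal.sup_mul, ← pow_add, add_comm 2 n]

/-- The condition `M ^ (n + 1) ≤ (b_i) M ^ n` depends only on the `b_i` modulo `M ^ 2`. -/
lemma Ideal.pow_succ_le_span_range_mul_pow_congr {ι : Type*} {a b : ι → R}
    (h : ∀ i, a i - b i ∈ M ^ 2) {n N : ℕ}
    (hN : M ^ (N + 1) ≤ Ideal.span (Set.range b) * M ^ N)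
    (hn : M ^ (n + 1) ≤ Ideal.span (Set.range a) * M ^ n ⊔ M ^ (n + 2)) :
    M ^ (n + 1) ≤ Ideal.span (Set.range b) * M ^ n := by
  refine Ideal.pow_succ_le_mul_pow_of_le_sup (K := n + N + 1) ?_ ?_
  · exact hn.trans (sup_le (Ideal.span_range_mul_pow_le_sup h n) le_sup_right)
  · exact (Ideal.pow_succ_le_mul_pow_of_le hN (Nat.le_add_left N n)).trans
      (Ideal.mul_mono_right (Ideal.pow_le_pow_right (Nat.le_add_right n N)))

lemma Ideal.isReductionOf_iff : J.IsReductionOf M ↔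
    J ≤ M ∧ ∃ N, M ^ (N + 1) ≤ J * M ^ N := by
  constructor
  · rintro ⟨hle, h⟩
    obtain ⟨N, hN⟩ := h.exists
    exact ⟨hle, N, hN.ge⟩
  · rintro ⟨hle, N, hN⟩
    refine ⟨hle, eventually_atTop.2 ⟨N, fun n hn => le_antisymm ?_
      (Ideal.pow_succ_le_mul_pow_of_le hN hn)⟩⟩
    rw [pow_succ']
    exact Ideal.mul_mono_left hle

lemma Ideal.IsReductionOf.reductionNumberWith_le_iff (h : J.IsReductionOf M) {n : ℕ} :
    J.reductionNumberWith M ≤ n ↔ M ^ (n + 1) ≤ J * M ^ n := by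
  have hle : ∀ m, J * M ^ m ≤ M ^ (m + 1) := fun m => by
    rw [pow_succ']
    exact Ideal.mul_mono_left h.1
  constructor
  · intro hn
    have hmem : J.reductionNumberWith M ∈ {n : ℕ | J * M ^ n = M ^ (n + 1)} :=
      Nat.sInf_mem h.2.exists
    exact Ideal.pow_succ_le_mul_pow_of_le (Eq.ge hmem) hn
  · intro hn
    exact Nat.sInf_le (le_antisymm (hle n) hn)

lemma Ideal.reductionNumber_le_iff {n : ℕ} : M.reductionNumber ≤ (n : ℕ∞) ↔
    ∃ J : Ideal R, J.IsMinimalReductionOf M ∧ M ^ (n + 1) ≤ J * M ^ n := by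
  constructor
  · intro h
    by_contra! hcon
    have hlt : ((n + 1 : ℕ) : ℕ∞) ≤ M.reductionNumber := by
      refine le_iInf₂ fun J hJ => ?_
      have := mt hJ.1.reductionNumberWith_le_iff.1 (hcon J hJ)
      exact_mod_cast not_le.1 this
    have : n + 1 ≤ n := by exact_mod_cast hlt.trans h
    omega
  · rintro ⟨J, hJ, h⟩
    exact iInf₂_le_of_le J hJ (by exact_mod_cast hJ.1.reductionNumberWith_le_iff.2 h)

lemma Ideal.span_range_eq_sum_span_singleton {ι : Type*} [Fintype ι] (a : ι → R) :
    Ideal.span (Set.range a) = ∑ i, Ideal.span {a i} := by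
  rw [Ideal.sum_eq_sup, Finset.sup_univ_eq_iSup, ← Set.iUnion_singleton_eq_range, Ideal.span_iUnion]

lemma Ideal.prod_mul_pow_eq {ι : Type*} {I : ι → Ideal R} {N : ℕ}
    (h : ∀ i, ∀ n ≥ N, I i * M ^ n = M ^ (n + 1)) (T : Finset ι) {n : ℕ} (hn : N ≤ n) :
    (∏ j ∈ T, I j) * M ^ n = M ^ (n + T.card) := by
  classical
  induction T using Finset.induction_on with
  | empty => simp
  | insert i T hi ih =>
    rw [Finset.prod_insert hi, mul_assoc, ih, h i _ (by omega), Finset.card_insert_of_notMem hi,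
      add_assoc]

lemma Ideal.prod_pow_mul_pow_eq {ι : Type*} {I : ι → Ideal R} {N : ℕ}
    (h : ∀ i, ∀ n ≥ N, I i * M ^ n = M ^ (n + 1)) (T : Finset ι) {n : ℕ} (hn : N ≤ n) (t : ℕ) :
    (∏ j ∈ T, I j) ^ t * M ^ n = M ^ (n + t * T.card) := by
  induction t with
  | zero => simp
  | succ t ih =>
    rw [pow_succ', mul_assoc, ih, Ideal.prod_mul_pow_eq h T (by omega)]
    congr 1
    ring

/-- A joint reduction of reductions of `M` generates a reduction of `M`. -/
lemma IsJointReduction.exists_pow_succ_le {d : ℕ} (hd : 1 ≤ d) {a : Fin d → R}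
    {I : Fin d → Ideal R} (ha : IsJointReduction a I) (hI : ∀ i, (I i).IsReductionOf M) :
    ∃ N, M ^ (N + 1) ≤ Ideal.span (Set.range a) * M ^ N := by
  obtain ⟨N, hN⟩ := eventually_atTop.1 (eventually_all.2 fun i => (hI i).2)
  have hN' : ∀ i, ∀ n ≥ N, I i * M ^ n = M ^ (n + 1) := fun i n hn => hN n hn i
  obtain ⟨t, ht⟩ := ha.2.2.exists
  have h1 := congrArg (fun K => K * M ^ N) ht
  rw [mul_assoc, Ideal.prod_pow_mul_pow_eq hN' _ le_rfl, Ideal.prod_pow_mul_pow_eq hN' _ le_rfl,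
    Finset.sum_mul, Finset.card_univ, Fintype.card_fin] at h1
  refine ⟨N + t * d + (d - 1), ?_⟩
  have h2 : N + t * d + (d - 1) + 1 = N + (t + 1) * d := by
    rw [add_mul]
    omega
  rw [h2, ← h1, Ideal.span_range_eq_sum_span_singleton, Finset.sum_mul]
  refine le_of_eq (Finset.sum_congr rfl fun i _ => ?_)
  rw [mul_assoc, Ideal.prod_mul_pow_eq hN' _ (Nat.le_add_right N _),
    Finset.card_erase_of_mem (Finset.mem_univ i), Finset.card_univ, Fintype.card_fin]

lemma Ideal.forall_sum_span_mul_pow_eq_iff {d : ℕ} (hd : 1 ≤ d) {a : Fin d → R}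
    (ha : ∀ i, a i ∈ M) :
    (∀ s : Fin d → ℕ, (∀ i, 1 ≤ s i) →
      ∑ i, Ideal.span {a i} * M ^ (∑ j, Function.update s i (s i - 1) j) = M ^ (∑ j, s j)) ↔
      M ^ d ≤ Ideal.span (Set.range a) * M ^ (d - 1) := by
  have hsum : ∀ s : Fin d → ℕ, (∀ i, 1 ≤ s i) →
      ∑ i, Ideal.span {a i} * M ^ (∑ j, Function.update s i (s i - 1) j) =
        Ideal.span (Set.range a) * M ^ (∑ j, s j - 1) := by
    intro s hs
    rw [Ideal.span_range_eq_sum_span_singleton, Finset.sum_mul]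
    refine Finset.sum_congr rfl fun i _ => ?_
    congr 2
    rw [Finset.sum_update_of_mem (Finset.mem_univ i),
      ← Finset.add_sum_erase Finset.univ s (Finset.mem_univ i), Finset.sdiff_singleton_eq_erase]
    have := hs i
    omega
  have hspan : Ideal.span (Set.range a) ≤ M := by
    rw [Ideal.span_le]
    rintro _ ⟨i, rfl⟩
    exact ha i
  constructor
  · intro h
    have h1 := h (fun _ => 1) fun _ => le_rfl
    rw [hsum _ fun _ => le_rfl] at h1
    simpa using h1.ge
  · intro h s hs
    rw [hsum s hs]
    have hds : d ≤ ∑ j, s j := by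
      simpa using Finset.sum_le_sum fun i (_ : i ∈ Finset.univ) => hs i
    obtain ⟨n, hn⟩ : ∃ n, ∑ j, s j = n + 1 := ⟨∑ j, s j - 1, by omega⟩
    rw [hn, Nat.add_sub_cancel]
    refine le_antisymm ?_ (Ideal.pow_succ_le_mul_pow_of_le (n := d - 1) ?_ (by omega))
    · rw [pow_succ']
      exact Ideal.mul_mono_left hspan
    · rwa [Nat.sub_add_cancel hd]

end Reduction

/-! ### Separation by finitely many vectors -/

/-- Over an infinite field, let `W` act by functionals on finitely many spaces of dimension at most
`d`, without common zeros. Then `d` elements of `W` already have no common zeros. -/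
lemma exists_fin_separating {k : Type*} [Field k] [Infinite k] {ι W : Type*} [Finite ι]
    [AddCommGroup W] [Module k W] {E : ι → Type*} [∀ s, AddCommGroup (E s)]
    [∀ s, Module k (E s)] [∀ s, Module.Finite k (E s)] (B : ∀ s, W →ₗ[k] Module.Dual k (E s))
    (d : ℕ) : ∀ U : ∀ s, Submodule k (E s), (∀ s, Module.finrank k (U s) ≤ d) →
      (∀ s, ∀ u ∈ U s, u ≠ 0 → ∃ w, B s w u ≠ 0) →
      ∃ a : Fin d → W, ∀ s, ∀ u ∈ U s, u ≠ 0 → ∃ i, B s (a i) u ≠ 0 := by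
  induction d with
  | zero =>
    intro U hU _
    refine ⟨Fin.elim0, fun s u hu hu0 => absurd ?_ hu0⟩
    have := Submodule.finrank_eq_zero.1 (Nat.le_zero.1 (hU s))
    rwa [this, Submodule.mem_bot] at hu
  | succ d ih =>
    intro U hU hB
    -- a vector `w` that acts by a nonzero functional on every nonzero `U s`
    have hw : ∃ w, ∀ s, U s ≠ ⊥ → ∃ u ∈ U s, B s w u ≠ 0 := by
      choose u hu hu0 using fun s : {s // U s ≠ ⊥} => (U s.1).exists_mem_ne_zero_of_ne_bot s.2
      by_contra! hcon
      have hcov : ⋃ s : {s // U s ≠ ⊥}, ((LinearMap.ker ((B s.1).flip (u s)) : Submodule k W) :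
          Set W) = Set.univ := by
        refine Set.eq_univ_of_forall fun w => ?_
        obtain ⟨s, hs, h⟩ := hcon w
        exact Set.mem_iUnion.2 ⟨⟨s, hs⟩, h _ (hu ⟨s, hs⟩)⟩
      obtain ⟨s, hs⟩ := Subspace.exists_eq_top_of_iUnion_eq_univ hcov
      obtain ⟨w, hw⟩ := hB s.1 _ (hu s) (hu0 s)
      exact hw (hs.ge (Submodule.mem_top (x := w)))
    obtain ⟨w, hw⟩ := hw
    obtain ⟨a, ha⟩ := ih (fun s => U s ⊓ LinearMap.ker (B s w)) (fun s => by
      rcases eq_or_ne (U s) ⊥ with h | h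
      · rw [h, bot_inf_eq, finrank_bot]; exact Nat.zero_le d
      · obtain ⟨u, hu, hu0⟩ := hw s h
        have hlt : U s ⊓ LinearMap.ker (B s w) < U s :=
          lt_of_le_of_ne inf_le_left fun he => hu0 ((he.ge hu).2)
        have := Submodule.finrank_lt_finrank_of_lt hlt
        have := hU s
        omega) (fun s u hu => hB s u hu.1)
    refine ⟨Fin.cons w a, fun s u hu hu0 => ?_⟩
    by_cases h : B s w u = 0
    · obtain ⟨i, hi⟩ := ha s u ⟨hu, h⟩ hu0
      exact ⟨i.succ, by rwa [Fin.cons_succ]⟩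
    · exact ⟨0, by rwa [Fin.cons_zero]⟩

/-! ### Minimal reductions of the maximal homogeneous ideal -/

section MinimalReduction

variable {k : Type*} [Field k] {V : Type*} {Δ : AbstractSimplicialComplex V}

open Classical in
/-- The pairing of `k[Δ]` with the points of the coordinate space `k^σ` of a face `σ`: the value of
the linear part of an element at a point. -/
def linPairing {σ : Finset V} (h : IsFaceOrEmpty Δ σ) :
    StanleyReisnerRing k Δ →ₗ[k] Module.Dual k (σ → k) :=
  (Fintype.linearCombination k fun i : σ => LinearMap.proj (R := k) (φ := fun _ : σ => k) i) ∘ₗ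
    LinearMap.pi fun i : σ =>
      (Polynomial.lcoeff k 1) ∘ₗ (lineMap (k := k) h (Pi.single (i : V) 1)).toLinearMap

open Classical in
lemma linPairing_apply {σ : Finset V} (h : IsFaceOrEmpty Δ σ) (r : StanleyReisnerRing k Δ)
    (u : σ → k) : linPairing h r u =
      ∑ i : σ, (lineMap h (Pi.single (i : V) 1) r).coeff 1 * u i := by
  simp [linPairing, Fintype.linearCombination_apply, LinearMap.sum_apply]

open Classical in
lemma linPairing_eq_zero_of_mem_sq {σ : Finset V} (h : IsFaceOrEmpty Δ σ)
    {r : StanleyReisnerRing k Δ} (hr : r ∈ srMaxIdeal k Δ ^ 2) (u : σ → k) :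
    linPairing h r u = 0 := by
  rw [linPairing_apply]
  refine Finset.sum_eq_zero fun i _ => ?_
  have := map_lineMap_srMaxIdeal_pow_le h (Pi.single (i : V) 1) 2
    (Ideal.mem_map_of_mem (lineMap h _) hr)
  rw [Ideal.mem_span_singleton] at this
  rw [Polynomial.X_pow_dvd_iff.1 this 1 (by norm_num), zero_mul]

open Polynomial in
lemma X_sq_dvd_lineMap_iff [Fintype V] {σ : Finset V} (h : IsFaceOrEmpty Δ σ) (u : V → k)
    {r : StanleyReisnerRing k Δ} (hr : r ∈ srMaxIdeal k Δ) :
    (X : k[X]) ^ 2 ∣ lineMap h u r ↔ linPairing h r (fun i : σ => u i) = 0 := by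
  classical
  obtain ⟨l, hl, hrl⟩ := exists_linearForm_sub_mem hr
  obtain ⟨c, rfl⟩ := exists_eq_sum_smul_srVar hl
  have hdvd : ∀ v : V → k, (X : k[X]) ^ 2 ∣
      lineMap h v r - C (∑ i ∈ σ, c i * v i) * X := by
    intro v
    have := map_lineMap_srMaxIdeal_pow_le h v 2 (Ideal.mem_map_of_mem (lineMap h v) hrl)
    rwa [Ideal.mem_span_singleton, map_sub, lineMap_sum_smul_srVar] at this
  have hcoeff : ∀ v : V → k, (lineMap h v r).coeff 1 = ∑ i ∈ σ, c i * v i := by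
    intro v
    have := X_pow_dvd_iff.1 (hdvd v) 1 (by norm_num)
    rwa [coeff_sub, coeff_C_mul, coeff_X_one, mul_one, sub_eq_zero] at this
  have hpair : linPairing h r (fun i : σ => u i) = ∑ i ∈ σ, c i * u i := by
    rw [linPairing_apply, ← Finset.sum_coe_sort σ]
    refine Finset.sum_congr rfl fun i _ => ?_
    rw [hcoeff, Finset.sum_eq_single (i : V)]
    · simp
    · intro j _ hj
      simp [hj]
    · exact fun hi => absurd i.2 hi
  rw [hpair]
  constructor
  · intro hX
    rw [← hcoeff]
    exact X_pow_dvd_iff.1 hX 1 (by norm_num)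
  · intro h0
    have := hdvd u
    rwa [h0, C_0, zero_mul, sub_zero] at this

/-- For elements of `𝔪`, `LinearPartsSpan` says that no nonzero point of the coordinate space of a
face pairs to zero with all of them. -/
lemma linearPartsSpan_iff [Fintype V] {L : Set (StanleyReisnerRing k Δ)}
    (hL : L ⊆ srMaxIdeal k Δ) : LinearPartsSpan L ↔
      ∀ (σ : Finset V) (h : IsFaceOrEmpty Δ σ) (u : σ → k), u ≠ 0 →
        ∃ l ∈ L, linPairing h l u ≠ 0 := by
  classical
  constructor
  · intro hLP σ h u hu
    obtain ⟨i, hi⟩ := Function.ne_iff.1 hu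
    set v : V → k := fun j => if hj : j ∈ σ then u ⟨j, hj⟩ else 0 with hv
    have hvu : (fun i : σ => v i) = u := by
      ext j
      simp [hv]
    obtain ⟨l, hl, hdvd⟩ := hLP σ h v ⟨i, i.2, by simpa [hv] using hi⟩
    rw [X_sq_dvd_lineMap_iff h v (hL hl), hvu] at hdvd
    exact ⟨l, hl, hdvd⟩
  · rintro hLP σ h u ⟨i, hi, hui⟩
    obtain ⟨l, hl, hne⟩ := hLP σ h (fun i : σ => u i) fun h0 => hui (congrFun h0 ⟨i, hi⟩)
    exact ⟨l, hl, fun hdvd => hne ((X_sq_dvd_lineMap_iff h u (hL hl)).1 hdvd)⟩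

lemma exists_linear_parts {ι : Type*} {a : ι → StanleyReisnerRing k Δ}
    (ha : ∀ i, a i ∈ srMaxIdeal k Δ) : ∃ b : ι → StanleyReisnerRing k Δ,
      (∀ i, b i ∈ linearForms k Δ) ∧ (∀ i, a i - b i ∈ srMaxIdeal k Δ ^ 2) := by
  choose b hb hab using fun i => exists_linearForm_sub_mem (ha i)
  exact ⟨b, hb, hab⟩

lemma LinearPartsSpan.of_linear_parts {ι : Type*} {a b : ι → StanleyReisnerRing k Δ}
    (hL : LinearPartsSpan (Set.range a)) (hab : ∀ i, a i - b i ∈ srMaxIdeal k Δ ^ 2) :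
    LinearPartsSpan (Set.range b) :=
  hL.congr (by rintro _ ⟨i, rfl⟩; exact ⟨b i, ⟨i, rfl⟩, hab i⟩)

lemma Ideal.IsReductionOf.linearPartsSpan {J : Ideal (StanleyReisnerRing k Δ)}
    (hJ : J.IsReductionOf (srMaxIdeal k Δ)) :
    LinearPartsSpan (J : Set (StanleyReisnerRing k Δ)) := by
  obtain ⟨N, hN⟩ := (Ideal.isReductionOf_iff.1 hJ).2
  refine linearPartsSpan_of_pow_succ_le (N := N) ?_
  rw [Ideal.span_eq]
  exact hN.trans le_sup_left

lemma LinearPartsSpan.isReductionOf [Fintype V] {ι : Type*} {b : ι → StanleyReisnerRing k Δ}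
    (hL : LinearPartsSpan (Set.range b)) (hb : ∀ i, b i ∈ linearForms k Δ) :
    (Ideal.span (Set.range b)).IsReductionOf (srMaxIdeal k Δ) := by
  refine Ideal.isReductionOf_iff.2 ⟨?_, hL.exists_pow_succ_le ?_⟩
  · rw [Ideal.span_le]
    rintro _ ⟨i, rfl⟩
    exact linearForms_le_srMaxIdeal (hb i)
  · rintro _ ⟨i, rfl⟩
    exact hb i

/-- The equality `𝔪 ^ d = (a_1, …, a_d) 𝔪 ^ (d - 1)` holds for one reduction with `d` generators if
and only if it holds for all of them: it says that `χ(Δ) = 1`. -/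
theorem srMaxIdeal_pow_le_span_range_mul_iff [Fintype V] {d : ℕ} (hd : 1 ≤ d)
    (hdim : ringKrullDim (StanleyReisnerRing k Δ) = d)
    (hCM : IsCohenMacaulay (StanleyReisnerRing k Δ)) {a : Fin d → StanleyReisnerRing k Δ}
    (ha : ∀ i, a i ∈ srMaxIdeal k Δ)
    (hN : ∃ N, srMaxIdeal k Δ ^ (N + 1) ≤ Ideal.span (Set.range a) * srMaxIdeal k Δ ^ N) :
    srMaxIdeal k Δ ^ d ≤ Ideal.span (Set.range a) * srMaxIdeal k Δ ^ (d - 1) ↔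
      simplicialEulerChar Δ = 1 := by
  obtain ⟨N, hN⟩ := hN
  obtain ⟨b, hb, hab⟩ := exists_linear_parts ha
  have hba : ∀ i, b i - a i ∈ srMaxIdeal k Δ ^ 2 := fun i => by
    rw [← neg_sub]
    exact neg_mem (hab i)
  have hL : LinearPartsSpan (Set.range b) :=
    (linearPartsSpan_of_pow_succ_le (hN.trans le_sup_left)).of_linear_parts hab
  obtain ⟨N', hN'⟩ := (Ideal.isReductionOf_iff.1 (hL.isReductionOf hb)).2
  rw [← hL.srMaxIdeal_pow_le_iff hd hdim hCM hb]
  obtain ⟨e, rfl⟩ : ∃ e, d = e + 1 := ⟨d - 1, by omega⟩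
  exact ⟨fun h => Ideal.pow_succ_le_span_range_mul_pow_congr hab hN' (h.trans le_sup_left),
    fun h => Ideal.pow_succ_le_span_range_mul_pow_congr hba hN (h.trans le_sup_left)⟩

/-- An ideal generated by a linear system of parameters is a minimal reduction of `𝔪`: the linear
parts of a reduction have no common zero on a face with `d` vertices, so that they span a space of
dimension at least `d`. -/
lemma LinearPartsSpan.isMinimalReductionOf [Fintype V] {d : ℕ}
    (hdim : ringKrullDim (StanleyReisnerRing k Δ) = d) {θ : Fin d → StanleyReisnerRing k Δ}
    (hL : LinearPartsSpan (Set.range θ)) (hθ : ∀ i, θ i ∈ linearForms k Δ) :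
    (Ideal.span (Set.range θ)).IsMinimalReductionOf (srMaxIdeal k Δ) := by
  refine ⟨hL.isReductionOf hθ, fun J hJ hJθ => ?_⟩
  set M := srMaxIdeal k Δ
  set Θ := Ideal.span (Set.range θ)
  obtain ⟨N, hN⟩ := (Ideal.isReductionOf_iff.1 hJ).2
  suffices h : Θ ≤ J ⊔ M * Θ by
    refine Ideal.le_of_le_sup_mul (N := N + 1) h (Ideal.mul_le_left.trans ?_)
    exact hN.trans Ideal.mul_le_left
  let φ : (Fin d → k) →ₗ[k] StanleyReisnerRing k Δ := Fintype.linearCombination k θ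
  have hφ : ∀ c, φ c = ∑ i, c i • θ i := fun c => Fintype.linearCombination_apply k θ c
  let Q : Submodule k (Fin d → k) := ((J ⊔ M * Θ).restrictScalars k).comap φ
  have hQ : Q = ⊤ := by
    by_contra hne
    have hlt : Module.finrank k Q < d := by
      simpa using Submodule.finrank_lt hne
    obtain ⟨σ, hσ, hcard⟩ := exists_face_card_eq hdim
    let T : (σ → k) →ₗ[k] Module.Dual k Q := (linPairing hσ ∘ₗ φ ∘ₗ Q.subtype).flip
    have hker : LinearMap.ker T ≠ ⊥ := by
      apply LinearMap.ker_ne_bot_of_finrank_lt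
      rw [Subspace.dual_finrank_eq, Module.finrank_fintype_fun_eq_card, Fintype.card_coe, hcard]
      exact hlt
    obtain ⟨u, hu, hu0⟩ := Submodule.exists_mem_ne_zero_of_ne_bot hker
    obtain ⟨l, hl, hne⟩ := (linearPartsSpan_iff hJ.1).1 hJ.linearPartsSpan σ hσ u hu0
    obtain ⟨r, hr⟩ := (Ideal.mem_span_range_iff_exists_fun).1 (hJθ hl)
    choose c hc using fun i => exists_sub_algebraMap_mem_srMaxIdeal (k := k) (r i)
    have hsub : l - φ c ∈ M * Θ := by
      rw [← hr, hφ, ← Finset.sum_sub_distrib]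
      refine Ideal.sum_mem _ fun i _ => ?_
      have hsmul : c i • θ i = algebraMap k _ (c i) * θ i := by
        obtain ⟨f, hf⟩ := Ideal.Quotient.mk_surjective (θ i)
        rw [← hf]
        exact congrArg (Ideal.Quotient.mk _) (MvPolynomial.smul_eq_C_mul f (c i))
      rw [hsmul, ← sub_mul]
      exact Ideal.mul_mem_mul (hc i) (Ideal.subset_span ⟨i, rfl⟩)
    have hcQ : c ∈ Q := by
      change φ c ∈ J ⊔ M * Θ
      rw [← sub_sub_cancel l (φ c)]
      exact Ideal.sub_mem _ (Ideal.mem_sup_left hl) (Ideal.mem_sup_right hsub)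
    have h0 : linPairing hσ (φ c) u = 0 := LinearMap.congr_fun hu ⟨c, hcQ⟩
    have h1 : linPairing hσ (l - φ c) u = 0 := by
      refine linPairing_eq_zero_of_mem_sq hσ ?_ u
      rw [pow_two]
      exact Ideal.mul_mono_right (hL.isReductionOf hθ).1 hsub
    apply hne
    rw [map_sub, LinearMap.sub_apply, h0, sub_zero] at h1
    exact h1
  rw [Ideal.span_le]
  rintro _ ⟨i, rfl⟩
  have h1 : Pi.single i 1 ∈ Q := hQ ▸ Submodule.mem_top
  change φ (Pi.single i 1) ∈ J ⊔ M * Θ at h1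
  rwa [show φ (Pi.single i 1) = θ i by simp [φ, Fintype.linearCombination_apply_single]] at h1

/-- Over an infinite field, a minimal reduction of `𝔪` is generated by `d` elements up to terms of
high order. -/
lemma Ideal.IsMinimalReductionOf.simplicialEulerChar_eq_one [Fintype V] [Infinite k] {d : ℕ}
    (hd : 1 ≤ d) (hdim : ringKrullDim (StanleyReisnerRing k Δ) = d)
    (hCM : IsCohenMacaulay (StanleyReisnerRing k Δ)) {J : Ideal (StanleyReisnerRing k Δ)}
    (hJ : J.IsMinimalReductionOf (srMaxIdeal k Δ))
    (hle : srMaxIdeal k Δ ^ d ≤ J * srMaxIdeal k Δ ^ (d - 1)) : simplicialEulerChar Δ = 1 := by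
  set M := srMaxIdeal k Δ with hM
  have hJM : J ≤ M := hJ.1.1
  obtain ⟨a, ha⟩ := exists_fin_separating (k := k) (ι := {σ // IsFaceOrEmpty Δ σ})
    (W := J.restrictScalars k) (E := fun σ => σ.1 → k)
    (fun σ => linPairing σ.2 ∘ₗ (J.restrictScalars k).subtype) d (fun _ => ⊤)
    (fun σ => by
      rw [finrank_top, Module.finrank_fintype_fun_eq_card, Fintype.card_coe]
      exact card_le_of_ringKrullDim_eq hdim σ.2)
    (fun σ u _ hu => by
      obtain ⟨l, hl, h⟩ := (linearPartsSpan_iff hJM).1 hJ.1.linearPartsSpan σ.1 σ.2 u hu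
      exact ⟨⟨l, hl⟩, h⟩)
  set a' : Fin d → StanleyReisnerRing k Δ := fun i => (a i : StanleyReisnerRing k Δ) with ha'
  have haJ : ∀ i, a' i ∈ J := fun i => (a i).2
  have hLa : LinearPartsSpan (Set.range a') := by
    rw [linearPartsSpan_iff (by rintro _ ⟨i, rfl⟩; exact hJM (haJ i))]
    intro σ h u hu
    obtain ⟨i, hi⟩ := ha ⟨σ, h⟩ u Submodule.mem_top hu
    exact ⟨a' i, ⟨i, rfl⟩, hi⟩
  obtain ⟨b, hb, hab⟩ := exists_linear_parts fun i => hJM (haJ i)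
  have hba : ∀ i, b i - a' i ∈ M ^ 2 := fun i => by
    rw [← neg_sub]
    exact neg_mem (hab i)
  have hLb := hLa.of_linear_parts hab
  obtain ⟨N, hN⟩ := (Ideal.isReductionOf_iff.1 (hLb.isReductionOf hb)).2
  obtain ⟨K, hK⟩ := (Ideal.isReductionOf_iff.1 hJ.1).2
  -- the reduction of `𝔪` generated by the `a_i` and a high power of `𝔪` is `J`
  have hred : (Ideal.span (Set.range a') ⊔ M ^ (K + 2)).IsReductionOf M := by
    refine Ideal.isReductionOf_iff.2 ⟨sup_le ?_ (Ideal.pow_le_self (by omega)), N, ?_⟩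
    · rw [Ideal.span_le]
      rintro _ ⟨i, rfl⟩
      exact hJM (haJ i)
    · refine Ideal.pow_succ_le_mul_pow_of_le_sup (K := K + 2 + N) ?_ ?_
      · rw [Ideal.sup_mul]
        exact (hN.trans (Ideal.span_range_mul_pow_le_sup hba N)).trans
          (sup_le_sup_right le_sup_left _)
      · rw [pow_add]
        exact Ideal.mul_mono_left le_sup_right
  have hle' : Ideal.span (Set.range a') ⊔ M ^ (K + 2) ≤ J := by
    refine sup_le ?_ ?_
    · rw [Ideal.span_le]
      rintro _ ⟨i, rfl⟩
      exact haJ i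
    · exact ((Ideal.pow_le_pow_right (by omega)).trans hK).trans Ideal.mul_le_left
  have hJle := hJ.2 hred hle'
  rw [← hLb.srMaxIdeal_pow_le_iff hd hdim hCM hb]
  obtain ⟨e, rfl⟩ : ∃ e, d = e + 1 := ⟨d - 1, by omega⟩
  refine Ideal.pow_succ_le_span_range_mul_pow_congr hab hN
    ((hle.trans (Ideal.mul_mono_left hJle)).trans ?_)
  rw [Ideal.sup_mul]
  exact sup_le_sup_left ((pow_add M (K + 2) e).ge.trans (Ideal.pow_le_pow_right (by omega))) _

end MinimalReduction

end

theorem mainTheorem4 {k : Type*} [Field k] (p : ℕ) [Fact p.Prime] [CharP k p]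
    {V : Type*} [Fintype V] (Δ : AbstractSimplicialComplex V)
    (d : ℕ) (hd : 1 ≤ d)
    (hdim : ringKrullDim (StanleyReisnerRing k Δ) = d)
    (hCM : IsCohenMacaulay (StanleyReisnerRing k Δ))
    (I : Fin d → Ideal (StanleyReisnerRing k Δ))
    (hI : ∀ i, ∃ θ : Fin d → StanleyReisnerRing k Δ,
      IsLinearSOP k Δ θ ∧ I i = Ideal.span (Set.range θ))
    (a : Fin d → StanleyReisnerRing k Δ) (ha : IsJointReduction a I) :
    (∀ T : Finset (Fin d), T.Nonempty →
      ∃ e : Fin (d + 1) → ℤ, IsTightHilbertCoeffs p d (∏ j ∈ T, I j) e) ∧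
    (Infinite k →
      List.TFAE [
        IsEulerianComplex Δ,
        (srMaxIdeal k Δ).reductionNumber ≤ ((d - 1 : ℕ) : ℕ∞),
        TightJointReductionEq p a I,
        alternatingTightSum p I = 0]) ∧
    (List.TFAE [
        IsEulerianComplex Δ,
        TightJointReductionEq p a I,
        alternatingTightSum p I = 0] ∧
      (IsEulerianComplex Δ → (srMaxIdeal k Δ).reductionNumber ≤ ((d - 1 : ℕ) : ℕ∞))) := by
  have hcard : ∀ σ, IsFaceOrEmpty Δ σ → σ.card ≤ d := fun σ => card_le_of_ringKrullDim_eq hdim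
  have hred : ∀ i, (I i).IsReductionOf (srMaxIdeal k Δ) := by
    intro i
    obtain ⟨θ, hθ, hIθ⟩ := hI i
    rw [hIθ]
    exact hθ.linearPartsSpan.isReductionOf hθ.2.1
  have hle : ∀ i, I i ≤ srMaxIdeal k Δ := fun i => (hred i).1
  have hsup : ∀ i F, IsFaceOrEmpty Δ F → srMaxIdeal k Δ ≤ I i ⊔ faceIdeal k Δ F := by
    intro i F hF
    obtain ⟨θ, hθ, hIθ⟩ := hI i
    rw [hIθ]
    exact hθ.linearPartsSpan.srMaxIdeal_le_sup (by rintro _ ⟨j, rfl⟩; exact hθ.2.1 j) hF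
  have haM : ∀ i, a i ∈ srMaxIdeal k Δ := fun i => hle i (ha.1 i)
  have h13 : TightJointReductionEq p a I ↔ IsEulerianComplex Δ := by
    rw [IsEulerianComplex, ← srMaxIdeal_pow_le_span_range_mul_iff hd hdim hCM haM
      (ha.exists_pow_succ_le hd hred), ← Ideal.forall_sum_span_mul_pow_eq_iff hd haM,
      TightJointReductionEq]
    simp_rw [tightClosure_prod_pow_eq p hle hsup]
  have h14 : alternatingTightSum p I = 0 ↔ IsEulerianComplex Δ := by
    rw [alternatingTightSum_eq p hd hcard hle hsup, sub_eq_zero, IsEulerianComplex]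
  have h12 : IsEulerianComplex Δ →
      (srMaxIdeal k Δ).reductionNumber ≤ ((d - 1 : ℕ) : ℕ∞) := by
    intro h
    obtain ⟨θ, hθ, -⟩ := hI ⟨0, hd⟩
    refine Ideal.reductionNumber_le_iff.2
      ⟨_, hθ.linearPartsSpan.isMinimalReductionOf hdim hθ.2.1, ?_⟩
    rw [Nat.sub_add_cancel hd]
    exact (hθ.linearPartsSpan.srMaxIdeal_pow_le_iff hd hdim hCM hθ.2.1).2 h
  refine ⟨fun T hT => (tightHilbertCoeffs_prod p hcard hle hsup T hT).1, fun hk => ?_, ?_, h12⟩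
  · tfae_have 1 → 2 := h12
    tfae_have 2 → 1 := by
      intro h
      obtain ⟨J, hJ, hJd⟩ := Ideal.reductionNumber_le_iff.1 h
      rw [Nat.sub_add_cancel hd] at hJd
      exact hJ.simplicialEulerChar_eq_one hd hdim hCM hJd
    tfae_have 3 ↔ 1 := h13
    tfae_have 4 ↔ 1 := h14
    tfae_finish
  · tfae_have 2 ↔ 1 := h13
    tfae_have 3 ↔ 1 := h14
    tfae_finish
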